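/- **Corollary 2 (coverage probability and spatial throughput in the MISO case).** *Model.* Base stations (BSs) with transmit power $P>0$ and $N_a\ge 1$ antennas each form a homogeneous Poisson point process of density $\lambda>0$ in $\mathbb R^2$. A typical single-antenna user $U_0$ is at the origin and is served by the nearest BS, $\mathrm{BS}_0$; the other BSs $\mathrm{BS}_i$ ($i\ge 1$) serve users $U_i$. With $\Delta h>0$ the difference of the antenna heights of BSs and users, put $d_i=\sqrt{\|\mathrm{BS}_i\|^2+\Delta h^2}$. The channel vectors $\mathbf h_{U_j,\mathrm{BS}_i}\in\mathbb C^{N_a}$ are independent of each other and of the BS process, and their entries are i.i.d. circularly symmetric complex normal variables whose real and imaginary parts are independent with mean $0$ and variance $v>0$. $\mathrm{BS}_i$ uses the single-user beamforming precoder $\mathbf v_i=\overline{\mathbf h_{U_i,\mathrm{BS}_i}}/\|\mathbf h_{U_i,\mathrm{BS}_i}\|$. The pathloss is $l_N(x)=K_nx^{-\alpha_n}$ for $R_n\le x<R_{n+1}$, $0\le n<N$, where $N\ge1$, $0=R_0<R_1<\dots<R_N=\infty$, $0\le\alpha_0\le\dots\le\alpha_{N-1}$, $\alpha_{N-1}>2$,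 $K_n=\prod_{i=1}^nR_i^{\alpha_i-\alpha_{i-1}}$. The interference is $I=\sum_{i\ge1}P\,|\mathbf h_{U_0,\mathrm{BS}_i}\mathbf v_i^{T}|^2\,l_N(d_i)$, the signal-to-interference ratio is $\mathsf{SIR}=P\,|\mathbf h_{U_0,\mathrm{BS}_0}\mathbf v_0^{T}|^2\,l_N(d_0)/I$, and for a threshold $\tau>0$ the coverage probability and the spatial throughput are $\mathsf{CP}=\mathbb P\{\mathsf{SIR}>\tau\}$ and $\mathsf{ST}=\lambda\,\mathbb P\{\mathsf{SIR}>\tau\}\log_2(1+\tau)$. *Claim.* For $d>0$ and $s\ge 0$ put $$\mathcal L_d(s)=\exp\Bigl(-2\pi\lambda\int_d^\infty x\Bigl(1-\frac1{1+2sP\,l_N(x)}\Bigr)\,dx\Bigr).$$ The integral converges, $\mathcal L_d$ is smooth on $(0,\infty)$, the sum $I$ is almost surely finite, and $\mathcal L_{d_0}$ is the Laplace transform of $I/v$ given $d_0$: $\mathbb E[e^{-sI/v}\mid d_0]=\mathcal L_{d_0}(s)$ almost surely, for every $s\ge0$ (for $v=1$, when $|\mathbf h_{U_0,\mathrm{BS}_0}\mathbf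 v_0^T|^2\sim\chi^2_{2N_a}$, it is the Laplace transform of $I$ itself). Moreover $$\mathsf{CP}=\mathbb E\Biggl[\sum_{k=0}^{N_a-1}\frac{(-s)^k}{k!}\,\frac{d^k}{ds^k}\mathcal L_{d_0}(s)\Big|_{s=\frac{\tau}{2P\,l_N(d_0)}}\Biggr],\qquad \mathsf{ST}=\lambda\,\mathsf{CP}\,\log_2(1+\tau),$$ where the expectation is over $d_0$ and its integrand is integrable. -/

import Mathlib

open MeasureTheory ProbabilityTheory Set Filter
open scoped NNReal ENNReal

noncomputable section

namespace MISO

/-- The Euclidean plane in which base stations (BSs) are deployed; the typical user is located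
at its origin. -/
abbrev Plane : Type := EuclideanSpace ℝ (Fin 2)

/-- The number of points of the family `X` (at the outcome `ω`) that lie in `A`. -/
def pointCount {Ω : Type*} (X : ℕ → Ω → Plane) (A : Set Plane) (ω : Ω) : ℕ∞ :=
  Set.encard {i : ℕ | X i ω ∈ A}

/-- `X` enumerates a homogeneous Poisson point process of density `lam` in the plane: the number of
points in a Borel set `A` of finite area is Poisson distributed with mean `lam * area A`, and the
numbers of points in finitely many disjoint such sets are independent. -/
structure IsPoissonProcess {Ω : Type*} [MeasurableSpace Ω] (μ : Measure Ω)
    (lam : ℝ≥0) (X : ℕ → Ω → Plane) : Prop where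
  measurable : ∀ i, Measurable (X i)
  hasLaw_count : ∀ A : Set Plane, MeasurableSet A → volume A ≠ ∞ →
    HasLaw (pointCount X A)
      ((poissonMeasure (lam * (volume A).toNNReal)).map (fun n : ℕ => (n : ℕ∞))) μ
  indep_count : ∀ (m : ℕ) (A : Fin m → Set Plane), (∀ j, MeasurableSet (A j)) →
    (∀ j, volume (A j) ≠ ∞) → Pairwise (fun i j => Disjoint (A i) (A j)) →
    iIndepFun (fun j => pointCount X (A j)) μ

/-- The centred circularly symmetric complex normal law whose real and imaginary parts are
independent real normal variables of variance `v`. -/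
def complexNormal (v : ℝ≥0) : Measure ℂ :=
  ((gaussianReal 0 v).prod (gaussianReal 0 v)).map (fun p : ℝ × ℝ => (⟨p.1, p.2⟩ : ℂ))

/-- The channel vectors `H j i` (from BS `i` to the user `j`) of `Na` antennas each are independent
of each other, and each has independent `complexNormal v` entries. -/
structure IsRayleighFading {Ω : Type*} [MeasurableSpace Ω] (μ : Measure Ω) (Na : ℕ) (v : ℝ≥0)
    (H : ℕ → ℕ → Ω → Fin Na → ℂ) : Prop where
  measurable : ∀ j i, Measurable (H j i)
  hasLaw : ∀ j i, HasLaw (H j i) (Measure.pi (fun _ => complexNormal v)) μ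
  indep : iIndepFun (fun p : ℕ × ℕ => H p.1 p.2) μ

/-- The single-user beamforming precoder for the channel vector `h`: the unit vector
`conj h / ‖h‖` (Euclidean norm). -/
def precoder {Na : ℕ} (h : Fin Na → ℂ) : Fin Na → ℂ :=
  fun k => star (h k) / (Real.sqrt (∑ m, ‖h m‖ ^ 2) : ℂ)

/-- The power gain `‖h vᵀ‖ ^ 2` at the typical user `0` of the signal of BS `i`; BS `i` serves the
user `i` and therefore uses the precoder for its channel `H i i` to that user. -/
def gain {Ω : Type*} {Na : ℕ} (H : ℕ → ℕ → Ω → Fin Na → ℂ) (i : ℕ) (ω : Ω) : ℝ :=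
  ‖∑ k, H 0 i ω k * precoder (H i i ω) k‖ ^ 2

/-- Parameters of the multi-slope pathloss model with `N` slopes: the exponents
`0 ≤ α 0 ≤ ⋯ ≤ α (N - 1)`, `2 < α (N - 1)`, and the break points
`0 = R 0 < R 1 < ⋯ < R (N - 1)`; the last slope extends to infinity. Other values are unused. -/
structure MultiSlope (N : ℕ) where
  α : ℕ → ℝ
  R : ℕ → ℝ
  N_pos : 0 < N
  α_zero_nonneg : 0 ≤ α 0
  α_mono : ∀ n, n + 1 < N → α n ≤ α (n + 1)
  two_lt_α_last : 2 < α (N - 1)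
  R_zero : R 0 = 0
  R_lt : ∀ n, n + 1 < N → R n < R (n + 1)

/-- The constant `K n = ∏ i = 1, …, n, R i ^ (α i - α (i - 1))`. -/
def MultiSlope.K {N : ℕ} (M : MultiSlope N) (n : ℕ) : ℝ :=
  ∏ i ∈ Finset.range n, M.R (i + 1) ^ (M.α (i + 1) - M.α i)

/-- The pathloss `K n * x ^ (-α n)` for `R n ≤ x < R (n + 1)`, where `R N = ∞`. -/
def MultiSlope.pathloss {N : ℕ} (M : MultiSlope N) (x : ℝ) : ℝ :=
  open Classical in
  ∑ n ∈ Finset.range N,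
    if M.R n ≤ x ∧ (n + 1 < N → x < M.R (n + 1)) then M.K n * x ^ (-M.α n) else 0

/-- The distance between the antennas of BS `i` and of the typical user, whose heights differ by
`Δh`. -/
def dist3 {Ω : Type*} (Δh : ℝ) (X : ℕ → Ω → Plane) (i : ℕ) (ω : Ω) : ℝ :=
  Real.sqrt (‖X i ω‖ ^ 2 + Δh ^ 2)

/-- The contribution of BS `i` to the power received by the typical user. -/
def power {Ω : Type*} {N Na : ℕ} (M : MultiSlope N) (P Δh : ℝ) (X : ℕ → Ω → Plane)
    (H : ℕ → ℕ → Ω → Fin Na → ℂ) (i : ℕ) (ω : Ω) : ℝ :=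
  P * gain H i ω * M.pathloss (dist3 Δh X i ω)

/-- The intercell interference: the power received from all BSs but BS `0`. -/
def interference {Ω : Type*} {N Na : ℕ} (M : MultiSlope N) (P Δh : ℝ) (X : ℕ → Ω → Plane)
    (H : ℕ → ℕ → Ω → Fin Na → ℂ) (ω : Ω) : ℝ :=
  ∑' i : ℕ, power M P Δh X H (i + 1) ω

/-- The signal-to-interference ratio at the typical user, which is served by BS `0`. -/
def sir {Ω : Type*} {N Na : ℕ} (M : MultiSlope N) (P Δh : ℝ) (X : ℕ → Ω → Plane)
    (H : ℕ → ℕ → Ω → Fin Na → ℂ) (ω : Ω) : ℝ :=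
  power M P Δh X H 0 ω / interference M P Δh X H ω

/-- The coverage probability with decoding threshold `τ`. -/
def coverage {Ω : Type*} [MeasurableSpace Ω] (μ : Measure Ω) {N Na : ℕ} (M : MultiSlope N)
    (P Δh τ : ℝ) (X : ℕ → Ω → Plane) (H : ℕ → ℕ → Ω → Fin Na → ℂ) : ℝ :=
  μ.real {ω | τ < sir M P Δh X H ω}

/-- The network spatial throughput. -/
def spatialThroughput {Ω : Type*} [MeasurableSpace Ω] (μ : Measure Ω) {N Na : ℕ}
    (M : MultiSlope N) (lam : ℝ≥0) (P Δh τ : ℝ) (X : ℕ → Ω → Plane)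
    (H : ℕ → ℕ → Ω → Fin Na → ℂ) : ℝ :=
  lam * μ.real {ω | τ < sir M P Δh X H ω} * Real.logb 2 (1 + τ)

/-- The integrand `x * (1 - 1 / (1 + 2 * s * P * l x))`. -/
def laplaceIntegrand {N : ℕ} (M : MultiSlope N) (P s x : ℝ) : ℝ :=
  x * (1 - 1 / (1 + 2 * s * P * M.pathloss x))

/-- The closed form of the Laplace transform of the interference at `s`, when the serving distance
is `d`. -/
def laplaceForm {N : ℕ} (M : MultiSlope N) (lam : ℝ≥0) (P d s : ℝ) : ℝ :=
  Real.exp (-2 * Real.pi * lam * ∫ x in Ioi d, laplaceIntegrand M P s x)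

/-- The sum `∑ k < Na, (-s) ^ k / k! * (d/ds) ^ k L s` at `s = τ / (2 * P * l d)`, when the serving
distance is `d`. -/
def coverageSum {N : ℕ} (M : MultiSlope N) (lam : ℝ≥0) (P τ : ℝ) (Na : ℕ) (d : ℝ) : ℝ :=
  ∑ k ∈ Finset.range Na,
    (-(τ / (2 * P * M.pathloss d))) ^ k / (k.factorial : ℝ) *
      iteratedDeriv k (laplaceForm M lam P d) (τ / (2 * P * M.pathloss d))

end MISO

end

/-! Write `D` for the serving distance, `c` for the height difference and `u(x) = 2 s P l(x)`. Two
facts about fading carry the result. An interfering gain is exponential with mean `2v`: the precoder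
is a unit vector independent of the channel it meets, and the complex normal law is rotation
invariant. The serving gain is `‖h‖²`, a sum of `Na` independent exponentials with mean `2v`, so its
tail is an Erlang sum.

Averaging over the fading first, each interferer at distance `x` contributes the factor `1 / (1 +
u(x))` to the Laplace transform of `I / v` at `s`. It remains to average these factors over the
positions given `D`. Instead of conditioning a Poisson process on its nearest point, the proof
applies the Laplace functional (`IsPoissonProcess.lintegral_expNeg_tsum`) to a weight that is
infinite below distance `b` and `log (1 + u)` beyond it. The infinite part forces `D ≥ b`, so the
expectation of the product over all stations, station 0 included, on `D ≥ b` equals `exp (-λπ(b² -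
c²)) * L_b(s)`. Taking `s = 0` gives the law of `D`. For general `s`, differentiating in `b`
(`lintegral_tail`) shows the same tail to be that of the law of `D` with density `L_D(s) / (1 +
u(D))`. Dividing by the factor of station 0 leaves `L_D(s)` for the others; this is
`IsPoissonProcess.setLIntegral_expNeg_tsum_succ`.

For coverage, integrating out the serving gain turns the probability into the mean of `e^{-sY}
∑_{k<Na} (sY)^k / k!` with `Y = I / v` and `s = τ / (2 P l(D))` (`measure_coverage`). Under the
conditional law of `Y` given `D`, the mean of `Y^k e^{-sY}` is `(-1)^k` times the `k`-th derivative
of the Laplace transform, which is `L_D`. So the conditional mean of the Erlang tail is exactly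
`coverageSum` (`sum_iteratedDeriv_laplace`, `coverageSum_ae_eq`), and the tower property concludes.

Positions and gains are handled in `[0, ∞]`, where sums always exist and `exp (-∞) = 0`; the real
interference is recovered once its finiteness is known. -/

namespace MISO
open scoped Topology

/-! ### The exponential of a negative extended number -/

/-- The function `x ↦ exp (-x)` on `[0, ∞]`. -/
noncomputable def expNeg (x : ℝ≥0∞) : ℝ≥0∞ := EReal.exp (-(x : EReal))

lemma continuous_expNeg : Continuous expNeg :=
  ENNReal.continuous_exp.comp (continuous_neg.comp continuous_coe_ennreal_ereal)

@[fun_prop] lemma measurable_expNeg : Measurable expNeg := continuous_expNeg.measurable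

lemma antitone_expNeg : Antitone expNeg := fun x y h => by
  simp only [expNeg, EReal.exp_le_exp_iff, EReal.neg_le_neg_iff]
  exact_mod_cast h

@[simp] lemma expNeg_zero : expNeg 0 = 1 := by simp [expNeg]

@[simp] lemma expNeg_top : expNeg ∞ = 0 := by simp [expNeg]

lemma expNeg_add (x y : ℝ≥0∞) : expNeg (x + y) = expNeg x * expNeg y := by
  rw [expNeg, expNeg, expNeg, ← EReal.exp_add, EReal.coe_ennreal_add, EReal.neg_add, sub_eq_add_neg]
  · left; exact EReal.coe_ennreal_ne_bot x
  · right; exact EReal.coe_ennreal_ne_bot y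

lemma expNeg_le_one (x : ℝ≥0∞) : expNeg x ≤ 1 := by
  rw [← expNeg_zero]; exact antitone_expNeg (zero_le)

lemma expNeg_ne_top (x : ℝ≥0∞) : expNeg x ≠ ∞ := ne_top_of_le_ne_top (by simp) (expNeg_le_one x)

lemma expNeg_ofReal {x : ℝ} (hx : 0 ≤ x) :
    expNeg (ENNReal.ofReal x) = ENNReal.ofReal (Real.exp (-x)) := by
  rw [expNeg, EReal.coe_ennreal_ofReal, max_eq_left hx, ← EReal.coe_neg, EReal.exp_coe]

lemma expNeg_eq_ofReal {x : ℝ≥0∞} (hx : x ≠ ∞) :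
    expNeg x = ENNReal.ofReal (Real.exp (-x.toReal)) := by
  rw [← expNeg_ofReal ENNReal.toReal_nonneg, ENNReal.ofReal_toReal hx]

lemma expNeg_ne_zero {x : ℝ≥0∞} (hx : x ≠ ∞) : expNeg x ≠ 0 := by
  rw [expNeg_eq_ofReal hx]; simp [Real.exp_pos]

lemma expNeg_sum {ι : Type*} (s : Finset ι) (f : ι → ℝ≥0∞) :
    expNeg (∑ i ∈ s, f i) = ∏ i ∈ s, expNeg (f i) := by
  classical
  induction s using Finset.induction_on with
  | empty => simp
  | insert a s ha ih => rw [Finset.sum_insert ha, Finset.prod_insert ha, expNeg_add, ih]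

lemma expNeg_mul_natCast (c : ℝ≥0∞) (n : ℕ) : expNeg (c * n) = expNeg c ^ n := by
  induction n with
  | zero => simp
  | succ n ih => rw [Nat.cast_succ, mul_add, mul_one, expNeg_add, ih, pow_succ]

lemma expNeg_lt_one {x : ℝ≥0∞} (hx : x ≠ 0) : expNeg x < 1 := by
  rw [expNeg, EReal.exp_lt_one_iff, EReal.neg_lt_zero]
  · exact_mod_cast pos_iff_ne_zero.2 hx

/-! ### Moments of the Poisson law -/

lemma lintegral_poissonMeasure (r : ℝ≥0) (f : ℕ → ℝ≥0∞) :
    ∫⁻ n, f n ∂poissonMeasure r =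
      ∑' n, ENNReal.ofReal (Real.exp (-r) * r ^ n / n.factorial) * f n := by
  simp [poissonMeasure, lintegral_sum_measure]

/-- The exponential series at `r * expNeg c`. The value `c = ∞` is included and gives the void
probability `exp (-r)`. -/
lemma lintegral_expNeg_poissonMeasure (r : ℝ≥0) (c : ℝ≥0∞) :
    ∫⁻ n : ℕ, expNeg (c * n) ∂poissonMeasure r = expNeg (r * (1 - expNeg c)) := by
  rw [lintegral_poissonMeasure]
  obtain ⟨q, hq0, hq1, hq⟩ : ∃ q : ℝ, 0 ≤ q ∧ q ≤ 1 ∧ expNeg c = ENNReal.ofReal q :=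
    ⟨(expNeg c).toReal, ENNReal.toReal_nonneg,
      ENNReal.toReal_le_of_le_ofReal zero_le_one (by simpa using expNeg_le_one c),
      (ENNReal.ofReal_toReal (expNeg_ne_top c)).symm⟩
  have hr : (r : ℝ≥0∞) = ENNReal.ofReal (r : ℝ) := by simp
  simp_rw [expNeg_mul_natCast, hq]
  rw [hr, ← ENNReal.ofReal_one, ← ENNReal.ofReal_sub _ hq0, ← ENNReal.ofReal_mul (NNReal.coe_nonneg r), expNeg_ofReal
    (mul_nonneg (NNReal.coe_nonneg r) (by linarith))]
  have key : HasSum (fun n : ℕ => Real.exp (-r) * r ^ n / n.factorial * q ^ n)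
      (Real.exp (-(r * (1 - q)))) := by
    have h := (NormedSpace.expSeries_div_hasSum_exp ((r : ℝ) * q)).mul_left (Real.exp (-r))
    rw [← Real.exp_eq_exp_ℝ, ← Real.exp_add] at h
    rw [show -(r * (1 - q)) = -(r : ℝ) + r * q by ring]
    refine h.congr_fun fun n => ?_
    rw [mul_pow]; ring
  rw [← key.tsum_eq, ENNReal.ofReal_tsum_of_nonneg (fun n => by positivity) key.summable]
  congr 1; ext n
  rw [← ENNReal.ofReal_pow hq0, ← ENNReal.ofReal_mul (by positivity)]

lemma lintegral_natCast_poissonMeasure (r : ℝ≥0) :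
    ∫⁻ n : ℕ, (n : ℝ≥0∞) ∂poissonMeasure r = r := by
  rw [lintegral_poissonMeasure]
  have key : HasSum (fun n : ℕ => Real.exp (-r) * r ^ n / n.factorial * n) r := by
    have h := (NormedSpace.expSeries_div_hasSum_exp (r : ℝ)).mul_left (Real.exp (-r) * r)
    rw [← Real.exp_eq_exp_ℝ, mul_right_comm, ← Real.exp_add, neg_add_cancel, Real.exp_zero,
      one_mul] at h
    rw [← hasSum_nat_add_iff' 1]
    simp only [Finset.range_one, Finset.sum_singleton, Nat.cast_zero, mul_zero, sub_zero]
    refine h.congr_fun fun n => ?_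
    rw [Nat.factorial_succ, pow_succ]; push_cast
    field_simp
  have h := ENNReal.ofReal_tsum_of_nonneg (fun n => by positivity) key.summable
  rw [key.tsum_eq, ENNReal.ofReal_coe_nnreal] at h
  rw [h]
  congr 1; ext n
  rw [ENNReal.ofReal_mul (by positivity)]; simp

/-! ### Poisson processes -/

section Poisson

lemma tsum_indicator_one_eq_pointCount {Ω : Type*} (X : ℕ → Ω → Plane) (A : Set Plane) (ω : Ω) :
    ∑' i, A.indicator (1 : Plane → ℝ≥0∞) (X i ω) = (pointCount X A ω : ℝ≥0∞) := by
  rw [pointCount, ← ENNReal.tsum_set_one, tsum_subtype {i | X i ω ∈ A} (fun _ => (1 : ℝ≥0∞))]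
  rfl

variable {Ω : Type*} [MeasurableSpace Ω] {μ : Measure Ω} {lam : ℝ≥0} {X : ℕ → Ω → Plane}

lemma IsPoissonProcess.measurable_pointCount (hX : IsPoissonProcess μ lam X) {A : Set Plane}
    (hA : MeasurableSet A) : Measurable fun ω => (pointCount X A ω : ℝ≥0∞) := by
  simp_rw [← tsum_indicator_one_eq_pointCount]
  exact Measurable.tsum fun i => (measurable_one.indicator hA).comp (hX.measurable i)

lemma IsPoissonProcess.lintegral_pointCount (hX : IsPoissonProcess μ lam X) {A : Set Plane}
    (hA : MeasurableSet A) (hA' : volume A ≠ ∞) (f : ℝ≥0∞ → ℝ≥0∞) :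
    ∫⁻ ω, f (pointCount X A ω) ∂μ =
      ∫⁻ n : ℕ, f n ∂poissonMeasure (lam * (volume A).toNNReal) := by
  have hm : Measurable fun n : ℕ∞ => f n := Measurable.of_discrete
  rw [(hX.hasLaw_count A hA hA').lintegral_comp hm.aemeasurable, lintegral_map hm (by fun_prop)]
  simp

/-- **Campbell's theorem**: the intensity measure of a Poisson process. -/
lemma IsPoissonProcess.sum_map_eq (hX : IsPoissonProcess μ lam X) :
    Measure.sum (fun i => μ.map (X i)) = (lam : ℝ≥0∞) • (volume : Measure Plane) := by
  have key : ∀ A : Set Plane, MeasurableSet A → volume A ≠ ∞ →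
      Measure.sum (fun i => μ.map (X i)) A = ((lam : ℝ≥0∞) • (volume : Measure Plane)) A := by
    intro A hA hA'
    rw [Measure.sum_apply _ hA]
    have : ∀ i, μ.map (X i) A = ∫⁻ ω, A.indicator (1 : Plane → ℝ≥0∞) (X i ω) ∂μ := by
      intro i
      rw [Measure.map_apply (hX.measurable i) hA, ← lintegral_indicator_one (hX.measurable i hA)]
      rfl
    simp_rw [this]
    rw [← lintegral_tsum (f := fun i ω => A.indicator (1 : Plane → ℝ≥0∞) (X i ω)) fun i =>
      ((measurable_one.indicator hA).comp (hX.measurable i)).aemeasurable]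
    simp_rw [tsum_indicator_one_eq_pointCount]
    rw [hX.lintegral_pointCount hA hA' (fun x => x), lintegral_natCast_poissonMeasure]
    simp [ENNReal.coe_toNNReal hA']
  symm
  refine Measure.FiniteSpanningSetsIn.ext (C := {A | MeasurableSet A ∧ volume A ≠ ∞})
    (μ := (lam : ℝ≥0∞) • (volume : Measure Plane)) ?_ ?_ ?_ ?_
  · refine le_antisymm ?_ (MeasurableSpace.generateFrom_le fun A hA => hA.1)
    intro A hA
    have : A = ⋃ n, A ∩ spanningSets (volume : Measure Plane) n := by
      rw [← inter_iUnion, iUnion_spanningSets, inter_univ]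
    rw [this]
    refine MeasurableSet.iUnion fun n => MeasurableSpace.measurableSet_generateFrom
      ⟨hA.inter (measurableSet_spanningSets _ n), ?_⟩
    exact ((measure_mono inter_subset_right).trans_lt (measure_spanningSets_lt_top _ n)).ne
  · rintro A ⟨hA, hA'⟩ B ⟨hB, _⟩ _
    exact ⟨hA.inter hB, ((measure_mono inter_subset_left).trans_lt hA'.lt_top).ne⟩
  · refine ⟨spanningSets volume, fun n => ⟨measurableSet_spanningSets _ n,
      (measure_spanningSets_lt_top _ n).ne⟩, fun n => ?_, iUnion_spanningSets _⟩
    rw [Measure.smul_apply, smul_eq_mul]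
    exact ENNReal.mul_lt_top (by simp) (measure_spanningSets_lt_top _ n)
  · intro A hA
    exact (key A hA.1 hA.2).symm

lemma IsPoissonProcess.lintegral_tsum (hX : IsPoissonProcess μ lam X) {φ : Plane → ℝ≥0∞}
    (hφ : Measurable φ) : ∫⁻ ω, ∑' i, φ (X i ω) ∂μ = lam * ∫⁻ x, φ x := by
  rw [MeasureTheory.lintegral_tsum (f := fun i ω => φ (X i ω)) fun i => (hφ.comp (hX.measurable i)).aemeasurable]
  have : ∀ i, ∫⁻ ω, φ (X i ω) ∂μ = ∫⁻ x, φ x ∂(μ.map (X i)) := fun i =>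
    (lintegral_map hφ (hX.measurable i)).symm
  simp_rw [this]
  rw [← lintegral_sum_measure, hX.sum_map_eq, lintegral_smul_measure, smul_eq_mul]

lemma IsPoissonProcess.iIndepFun_pointCount (hX : IsPoissonProcess μ lam X) {ι : Type*} [Fintype ι]
    (A : ι → Set Plane) (hA : ∀ j, MeasurableSet (A j)) (hA' : ∀ j, volume (A j) ≠ ∞)
    (hd : Pairwise fun i j => Disjoint (A i) (A j)) :
    iIndepFun (fun j => pointCount X (A j)) μ := by
  have e := Fintype.equivFin ι
  have h := hX.indep_count _ (fun j => A (e.symm j)) (fun j => hA _) (fun j => hA' _)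
    (fun i j hij => hd (e.symm.injective.ne hij))
  have := h.precomp (g := e) e.injective
  simpa [Function.comp_def] using this

/-- The sum over the points is a linear combination of the independent Poisson counts of the level
sets. The level 0 contributes nothing, so it alone may have infinite area. -/
lemma IsPoissonProcess.lintegral_expNeg_simpleFunc (hX : IsPoissonProcess μ lam X)
    (f : SimpleFunc Plane ℝ≥0∞) (hf : ∀ c ≠ 0, volume (f ⁻¹' {c}) ≠ ∞) :
    ∫⁻ ω, expNeg (∑' i, f (X i ω)) ∂μ = expNeg (lam * ∫⁻ x, (1 - expNeg (f x))) := by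
  classical
  set S := f.range.erase 0 with hS
  have hval : ∀ x, f x = ∑ c : S, (c : ℝ≥0∞) * (f ⁻¹' {(c : ℝ≥0∞)}).indicator 1 x := by
    intro x
    by_cases h0 : f x = 0
    · rw [h0, eq_comm]
      refine Finset.sum_eq_zero fun c _ => ?_
      rw [indicator_of_notMem, mul_zero]
      simp only [mem_preimage, mem_singleton_iff, h0]
      exact (Finset.ne_of_mem_erase c.2).symm
    · rw [Finset.sum_eq_single ⟨f x, Finset.mem_erase.2 ⟨h0, by simp⟩⟩]
      · simp
      · intro c _ hc
        rw [indicator_of_notMem, mul_zero]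
        simp only [mem_preimage, mem_singleton_iff]
        intro h; exact hc (Subtype.ext h.symm)
      · simp
  have hsum : ∀ ω, ∑' i, f (X i ω) = ∑ c : S, (c : ℝ≥0∞) * pointCount X (f ⁻¹' {(c : ℝ≥0∞)}) ω := by
    intro ω
    simp_rw [← tsum_indicator_one_eq_pointCount, ← ENNReal.tsum_mul_left]
    rw [← Summable.tsum_finsetSum fun _ _ => ENNReal.summable]
    exact tsum_congr fun i => hval _
  have hne : ∀ c : S, volume (f ⁻¹' {(c : ℝ≥0∞)}) ≠ ∞ := fun c =>
    hf c (Finset.ne_of_mem_erase c.2)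
  have hind := hX.iIndepFun_pointCount (fun c : S => f ⁻¹' {(c : ℝ≥0∞)})
    (fun c => f.measurableSet_fiber _) hne (fun c d hcd => by
      refine disjoint_left.2 fun x hx hx' => hcd (Subtype.ext ?_)
      simp only [mem_preimage, mem_singleton_iff] at hx hx'
      rw [← hx, hx'])
  have hind' := hind.comp (fun (c : S) (n : ℕ∞) => expNeg ((c : ℝ≥0∞) * n))
    (fun c => Measurable.of_discrete)
  simp_rw [hsum, expNeg_sum]
  rw [lintegral_prod_eq_prod_lintegral_of_indepFun Finset.univ
    (fun (c : S) ω => expNeg ((c : ℝ≥0∞) * pointCount X (f ⁻¹' {(c : ℝ≥0∞)}) ω)) hind'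
    (fun c => measurable_expNeg.comp
      ((hX.measurable_pointCount (f.measurableSet_fiber _)).const_mul _))]
  have hterm : ∀ c : S, ∫⁻ ω, expNeg ((c : ℝ≥0∞) * pointCount X (f ⁻¹' {(c : ℝ≥0∞)}) ω) ∂μ =
      expNeg (lam * ((1 - expNeg c) * volume (f ⁻¹' {(c : ℝ≥0∞)}))) := by
    intro c
    rw [hX.lintegral_pointCount (f.measurableSet_fiber _) (hne c)
      (fun x => expNeg ((c : ℝ≥0∞) * x)), lintegral_expNeg_poissonMeasure]
    rw [ENNReal.coe_mul, ENNReal.coe_toNNReal (hne c)]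
    congr 1; ring
  simp_rw [hterm]
  rw [← expNeg_sum, ← Finset.mul_sum, Finset.sum_coe_sort S
    (fun c => (1 - expNeg c) * volume (f ⁻¹' {c})), hS]
  congr 2
  have h1 : ∫⁻ x, (1 - expNeg (f x)) = ∫⁻ x, (f.map fun c => 1 - expNeg c) x := rfl
  rw [h1, SimpleFunc.lintegral_eq_lintegral, SimpleFunc.map_lintegral]
  by_cases h : (0 : ℝ≥0∞) ∈ f.range
  · rw [← Finset.add_sum_erase _ _ h]; simp
  · rw [Finset.erase_eq_of_notMem h]

/-- The **Laplace functional** of a Poisson process. -/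
lemma IsPoissonProcess.lintegral_expNeg_tsum [IsProbabilityMeasure μ]
    (hX : IsPoissonProcess μ lam X)
    {φ : Plane → ℝ≥0∞} (hφ : Measurable φ) (hfin : ∫⁻ x, (1 - expNeg (φ x)) ≠ ∞) :
    ∫⁻ ω, expNeg (∑' i, φ (X i ω)) ∂μ = expNeg (lam * ∫⁻ x, (1 - expNeg (φ x))) := by
  set f := SimpleFunc.eapprox φ with hf
  have hmono : ∀ x, Monotone fun n => f n x := fun x m n h => SimpleFunc.monotone_eapprox φ h x
  have hlim : ∀ x, Tendsto (fun n => f n x) atTop (𝓝 (φ x)) := fun x =>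
    SimpleFunc.tendsto_eapprox hφ x
  have hle : ∀ n x, f n x ≤ φ x := fun n x => (hmono x).ge_of_tendsto (hlim x) n
  -- Markov's inequality: on the level set `1 - exp (-φ)` is at least `1 - exp (-c) > 0`, and its
  -- integral is finite.
  have hlevel : ∀ n, ∀ c ≠ 0, volume (f n ⁻¹' {c}) ≠ ∞ := by
    intro n c hc
    have hc1 : 1 - expNeg c ≠ 0 := (tsub_pos_of_lt (expNeg_lt_one hc)).ne'
    have := meas_ge_le_lintegral_div (μ := (volume : Measure Plane))
      (f := fun x => 1 - expNeg (φ x)) (by fun_prop) hc1 (by finiteness)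
    refine ((measure_mono ?_).trans_lt (this.trans_lt (ENNReal.div_lt_top hfin hc1))).ne
    intro x hx
    simp only [mem_preimage, mem_singleton_iff] at hx
    exact tsub_le_tsub_left (antitone_expNeg (hx ▸ hle n x)) _
  have h1 : Tendsto (fun n => ∫⁻ ω, expNeg (∑' i, f n (X i ω)) ∂μ) atTop
      (𝓝 (∫⁻ ω, expNeg (∑' i, φ (X i ω)) ∂μ)) := by
    refine tendsto_lintegral_of_dominated_convergence (fun _ => 1) (fun n => ?_) (fun n => ?_)
      (by simp) ?_
    · exact measurable_expNeg.comp
        (Measurable.tsum fun i => (f n).measurable.comp (hX.measurable i))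
    · exact ae_of_all _ fun ω => expNeg_le_one _
    · refine ae_of_all _ fun ω => (continuous_expNeg.tendsto _).comp ?_
      have := lintegral_tendsto_of_tendsto_of_monotone (μ := Measure.count)
        (f := fun n i => f n (X i ω)) (F := fun i => φ (X i ω))
        (fun n => Measurable.of_discrete.aemeasurable)
        (ae_of_all _ fun i => hmono _) (ae_of_all _ fun i => hlim _)
      simpa [lintegral_count] using this
  have h2 : Tendsto (fun n => expNeg (lam * ∫⁻ x, (1 - expNeg (f n x)))) atTop
      (𝓝 (expNeg (lam * ∫⁻ x, (1 - expNeg (φ x))))) := by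
    refine (continuous_expNeg.tendsto _).comp
      (ENNReal.Tendsto.const_mul ?_ (Or.inr ENNReal.coe_ne_top))
    refine lintegral_tendsto_of_tendsto_of_monotone
      (fun n => (by fun_prop : Measurable _).aemeasurable) (ae_of_all _ fun x m n h => ?_)
      (ae_of_all _ fun x => ?_)
    · exact tsub_le_tsub_left (antitone_expNeg (hmono x h)) _
    · exact ENNReal.Tendsto.sub tendsto_const_nhds ((continuous_expNeg.tendsto _).comp (hlim x))
        (Or.inl (by simp))
  refine tendsto_nhds_unique h1 ?_
  simpa only [hX.lintegral_expNeg_simpleFunc _ (hlevel _)] using h2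

end Poisson

/-! ### The multi-slope pathloss -/

namespace MultiSlope

variable {N : ℕ} (M : MultiSlope N)

lemma R_mono {i j : ℕ} (hij : i ≤ j) (hj : j < N) : M.R i ≤ M.R j := by
  induction j, hij using Nat.le_induction with
  | base => exact le_rfl
  | succ k _ ih => exact (ih (by omega)).trans (M.R_lt k hj).le

lemma R_pos {i : ℕ} (h0 : 0 < i) (hi : i < N) : 0 < M.R i := by
  have h := M.R_lt 0 (by omega)
  rw [M.R_zero] at h
  exact h.trans_le (M.R_mono (by omega) hi)

lemma exists_slope {x : ℝ} (hx : 0 ≤ x) :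
    ∃ n < N, M.R n ≤ x ∧ (n + 1 < N → x < M.R (n + 1)) := by
  classical
  have hN := M.N_pos
  set n := Nat.findGreatest (fun n => M.R n ≤ x) (N - 1) with hn
  have h0 : M.R 0 ≤ x := by rwa [M.R_zero]
  refine ⟨n, ?_, Nat.findGreatest_spec (P := fun n => M.R n ≤ x) (Nat.zero_le _) h0, fun h => ?_⟩
  · have := Nat.findGreatest_le (P := fun n => M.R n ≤ x) (N - 1); omega
  · have := Nat.findGreatest_is_greatest (P := fun n => M.R n ≤ x) (n := N - 1) (k := n + 1)
      (by omega) (by omega)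
    exact not_le.1 this

lemma pathloss_eq {x : ℝ} {n : ℕ} (hn : n < N) (h1 : M.R n ≤ x)
    (h2 : n + 1 < N → x < M.R (n + 1)) : M.pathloss x = M.K n * x ^ (-M.α n) := by
  classical
  rw [pathloss, Finset.sum_eq_single n]
  · rw [if_pos ⟨h1, h2⟩]
  · intro m hm hmn
    rw [Finset.mem_range] at hm
    refine if_neg fun ⟨h3, h4⟩ => ?_
    rcases lt_or_gt_of_ne hmn with h | h
    · exact absurd (h4 (by omega)) (not_lt.2 ((M.R_mono (by omega) hn).trans h1))
    · exact absurd (h2 (by omega)) (not_lt.2 ((M.R_mono (by omega) hm).trans h3))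
  · intro h; exact absurd (Finset.mem_range.2 hn) h

/-- A closed form of the pathloss without case distinction. -/
lemma pathloss_eq_prod {x : ℝ} (hx : 0 < x) :
    M.pathloss x = x ^ (-M.α 0) *
      ∏ i ∈ Finset.range (N - 1), (max 1 (x / M.R (i + 1))) ^ (-(M.α (i + 1) - M.α i)) := by
  obtain ⟨n, hn, h1, h2⟩ := M.exists_slope hx.le
  rw [M.pathloss_eq hn h1 h2, K,
    ← Finset.prod_subset (Finset.range_subset_range.2 (show n ≤ N - 1 by omega))]
  · have : ∀ i ∈ Finset.range n, (max 1 (x / M.R (i + 1))) ^ (-(M.α (i + 1) - M.α i)) =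
        M.R (i + 1) ^ (M.α (i + 1) - M.α i) * x ^ (-(M.α (i + 1) - M.α i)) := by
      intro i hi
      rw [Finset.mem_range] at hi
      have hR := M.R_pos (Nat.succ_pos i) (show i + 1 < N by omega)
      rw [max_eq_right ((one_le_div hR).2 ((M.R_mono (by omega) hn).trans h1)),
        Real.div_rpow hx.le hR.le, Real.rpow_neg hR.le, div_inv_eq_mul, mul_comm]
    rw [Finset.prod_congr rfl this, Finset.prod_mul_distrib, mul_left_comm]
    congr 1
    rw [← Real.rpow_sum_of_pos hx, ← Real.rpow_add hx, Finset.sum_neg_distrib,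
      Finset.sum_range_sub]
    congr 1; ring
  · intro i hi hi'
    rw [Finset.mem_range] at hi hi'
    have hR := M.R_pos (Nat.succ_pos i) (show i + 1 < N by omega)
    -- Break points beyond `x` contribute the factor 1; the exponents of the others telescope to `-α
    -- n`.
    rw [max_eq_left, Real.one_rpow]
    exact (div_le_one hR).2 ((h2 (by omega)).le.trans (M.R_mono (by omega) (by omega)))

lemma pathloss_pos {x : ℝ} (hx : 0 < x) : 0 < M.pathloss x := by
  rw [M.pathloss_eq_prod hx]
  exact mul_pos (Real.rpow_pos_of_pos hx _) (Finset.prod_pos fun i _ =>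
    Real.rpow_pos_of_pos (lt_max_of_lt_left one_pos) _)

lemma continuousOn_pathloss : ContinuousOn M.pathloss (Ioi 0) := by
  have : ContinuousOn (fun x : ℝ => x ^ (-M.α 0) *
      ∏ i ∈ Finset.range (N - 1), (max 1 (x / M.R (i + 1))) ^ (-(M.α (i + 1) - M.α i)))
      (Ioi 0) := by
    refine ContinuousOn.mul (continuousOn_id.rpow_const fun x hx => Or.inl (ne_of_gt hx))
      (continuousOn_finsetProd _ fun i _ => ContinuousOn.rpow_const (by fun_prop) fun x _ =>
        Or.inl (lt_max_of_lt_left one_pos).ne')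
  exact this.congr fun x hx => M.pathloss_eq_prod hx

@[fun_prop] lemma measurable_pathloss : Measurable M.pathloss := by
  classical
  refine Finset.measurable_fun_sum _ fun n _ => Measurable.ite ?_ (by fun_prop) measurable_const
  by_cases h : n + 1 < N
  · simp only [h, forall_true_left]
    exact measurableSet_Ici.inter measurableSet_Iio
  · simp only [h, IsEmpty.forall_iff, and_true]
    exact measurableSet_Ici

lemma pathloss_nonneg {x : ℝ} (hx : 0 < x) : 0 ≤ M.pathloss x := (M.pathloss_pos hx).le

/-- Continuity settles the compact part up to the last break point; beyond it the integrand is a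
multiple of `x ^ (1 - α (N - 1))`, with exponent below `-1`. This dominates every integral in the
closed form. -/
lemma integrableOn_mul_pathloss {d : ℝ} (hd : 0 < d) :
    IntegrableOn (fun x => x * M.pathloss x) (Ioi d) := by
  set r := max d (M.R (N - 1)) with hr
  have hN := M.N_pos
  have hr0 : 0 < r := hd.trans_le (le_max_left _ _)
  rw [← Ioc_union_Ioi_eq_Ioi (le_max_left d (M.R (N - 1)))]
  refine IntegrableOn.union ?_ ?_
  · refine (ContinuousOn.integrableOn_Icc ?_).mono_set Ioc_subset_Icc_self
    exact continuousOn_id.mul (M.continuousOn_pathloss.mono fun x hx => hd.trans_le hx.1)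
  · have h := (integrableOn_Ioi_rpow_of_lt (a := 1 - M.α (N - 1))
      (by linarith [M.two_lt_α_last]) hr0).const_mul (M.K (N - 1))
    refine IntegrableOn.congr_fun h (fun x hx => ?_) measurableSet_Ioi
    have hx0 : 0 < x := hr0.trans hx
    rw [M.pathloss_eq (n := N - 1) (by omega) ((le_max_right _ _).trans (le_of_lt hx))
      (by omega), sub_eq_add_neg, Real.rpow_add hx0, Real.rpow_one]
    ring

end MultiSlope

/-! ### The closed form of the Laplace transform -/

section Laplace

variable {N : ℕ} (M : MultiSlope N) {lam : ℝ≥0} {P s d : ℝ}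

lemma laplaceIntegrand_nonneg (hP : 0 < P) (hs : 0 ≤ s) {x : ℝ} (hx : 0 < x) :
    0 ≤ laplaceIntegrand M P s x := by
  have := M.pathloss_pos hx
  refine mul_nonneg hx.le (sub_nonneg.2 ((div_le_one (by positivity)).2 ?_))
  have : 0 ≤ 2 * s * P * M.pathloss x := by positivity
  linarith

@[fun_prop] lemma measurable_laplaceIntegrand : Measurable (laplaceIntegrand M P s) := by
  unfold laplaceIntegrand; fun_prop

lemma integrableOn_laplaceIntegrand (hP : 0 < P) (hs : 0 ≤ s) (hd : 0 < d) :
    IntegrableOn (laplaceIntegrand M P s) (Ioi d) := by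
  refine Integrable.mono' ((M.integrableOn_mul_pathloss hd).const_mul (2 * s * P))
    (measurable_laplaceIntegrand M).aestronglyMeasurable
    ((ae_restrict_iff' measurableSet_Ioi).2 (ae_of_all _ fun x hx => ?_))
  have hx0 : 0 < x := hd.trans hx
  have hl := M.pathloss_pos hx0
  have h0 : 0 ≤ 2 * s * P * M.pathloss x := by positivity
  rw [Real.norm_of_nonneg (laplaceIntegrand_nonneg M hP hs hx0), laplaceIntegrand,
    one_sub_div (by positivity), add_sub_cancel_left, mul_left_comm]
  exact mul_le_mul_of_nonneg_left (div_le_self h0 (by linarith)) hx0.le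

/-- The holomorphic extension of the exponent of the Laplace transform to the right half-plane. -/
lemma differentiableOn_integral_laplace (hP : 0 < P) (hd : 0 < d) :
    DifferentiableOn ℂ (fun z : ℂ => ∫ x in Ioi d,
      (x : ℂ) * (1 - 1 / (1 + 2 * z * P * M.pathloss x))) {z | 0 < z.re} := by
  intro z₀ hz₀
  have hU : {z : ℂ | 0 < z.re} ∈ 𝓝 z₀ :=
    (isOpen_lt continuous_const Complex.continuous_re).mem_nhds hz₀
  -- The denominator has real part at least 1 on the whole half-plane, so one integrable bound for
  -- the derivative serves all `z`.
  have hden : ∀ z : ℂ, 0 < z.re → ∀ x : ℝ, 0 < x →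
      1 ≤ ‖1 + 2 * z * P * M.pathloss x‖ := by
    intro z hz x hx
    have hl := M.pathloss_pos hx
    refine le_trans ?_ (Complex.re_le_norm _)
    have : (1 + 2 * z * P * M.pathloss x).re = 1 + 2 * z.re * P * M.pathloss x := by simp
    rw [this]
    have : 0 < 2 * z.re * P * M.pathloss x := by positivity
    linarith
  have hne : ∀ z : ℂ, 0 < z.re → ∀ x : ℝ, 0 < x → 1 + 2 * z * P * M.pathloss x ≠ 0 :=
    fun z hz x hx h => by have := hden z hz x hx; rw [h, norm_zero] at this; linarith
  have hmeas : ∀ z : ℂ, Measurable fun x : ℝ =>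
      (x : ℂ) * (1 - 1 / (1 + 2 * z * P * M.pathloss x)) := fun z => by
    have : Measurable fun x : ℝ => ((M.pathloss x : ℝ) : ℂ) :=
      Complex.measurable_ofReal.comp M.measurable_pathloss
    fun_prop
  have hlm : Measurable fun x : ℝ => ((M.pathloss x : ℝ) : ℂ) :=
      Complex.measurable_ofReal.comp M.measurable_pathloss
  refine ((hasDerivAt_integral_of_dominated_loc_of_deriv_le
    (F' := fun (z : ℂ) (x : ℝ) => (x : ℂ) * (2 * P * M.pathloss x /
      (1 + 2 * z * P * M.pathloss x) ^ 2))
    (bound := fun x => 2 * P * (x * M.pathloss x)) hU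
    (Eventually.of_forall fun z => (hmeas z).aestronglyMeasurable) ?_ ?_ ?_
    ((M.integrableOn_mul_pathloss hd).const_mul _) ?_).2).differentiableAt.differentiableWithinAt
  · refine Integrable.mono' ((M.integrableOn_mul_pathloss hd).const_mul (2 * ‖z₀‖ * P))
      (hmeas z₀).aestronglyMeasurable
      ((ae_restrict_iff' measurableSet_Ioi).2 (ae_of_all _ fun x hx => ?_))
    have hx0 : 0 < x := hd.trans hx
    have hl := M.pathloss_pos hx0
    rw [one_sub_div (hne z₀ hz₀ x hx0), add_sub_cancel_left, norm_mul, norm_div]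
    simp only [norm_mul, Complex.norm_real, Complex.norm_ofNat, Real.norm_eq_abs, abs_of_pos hx0,
      abs_of_pos hP, abs_of_pos hl]
    rw [mul_left_comm]
    exact mul_le_mul_of_nonneg_left (div_le_self (by positivity) (hden z₀ hz₀ x hx0)) hx0.le
  · exact (by fun_prop : Measurable _).aestronglyMeasurable
  · refine (ae_restrict_iff' measurableSet_Ioi).2 (ae_of_all _ fun x hx z hz => ?_)
    have hx0 : 0 < x := hd.trans hx
    have hl := M.pathloss_pos hx0
    rw [norm_mul, norm_div, norm_pow]
    simp only [norm_mul, Complex.norm_real, Complex.norm_ofNat, Real.norm_eq_abs, abs_of_pos hx0,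
      abs_of_pos hP, abs_of_pos hl]
    rw [mul_left_comm (2 * P)]
    exact mul_le_mul_of_nonneg_left (div_le_self (by positivity)
      (one_le_pow₀ (hden z hz x hx0))) hx0.le
  · refine (ae_restrict_iff' measurableSet_Ioi).2 (ae_of_all _ fun x hx z hz => ?_)
    have hx0 : 0 < x := hd.trans hx
    have h1 : HasDerivAt (fun z : ℂ => 1 + 2 * z * P * M.pathloss x) (2 * P * M.pathloss x) z := by
      have := ((((hasDerivAt_id z).const_mul 2).mul_const (P : ℂ)).mul_const
        (M.pathloss x : ℂ)).const_add 1
      simpa using this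
    have h2 := ((h1.inv (hne z hz x hx0)).const_sub 1).const_mul (x : ℂ)
    simp only [one_div]
    exact h2.congr_deriv (by rw [neg_div, neg_neg])

/-- Holomorphy yields all derivatives from a single differentiation under the integral sign; the
exponent is the real part of the extension on the positive axis. -/
lemma contDiffOn_laplaceForm (hP : 0 < P) (hd : 0 < d) :
    ContDiffOn ℝ ((⊤ : ℕ∞) : WithTop ℕ∞) (laplaceForm M lam P d) (Ioi 0) := by
  have h1 : ContDiffOn ℝ ((⊤ : ℕ∞) : WithTop ℕ∞) (fun z : ℂ => ∫ x in Ioi d,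
      (x : ℂ) * (1 - 1 / (1 + 2 * z * P * M.pathloss x))) {z | 0 < z.re} :=
    ((differentiableOn_integral_laplace M hP hd).contDiffOn
      (isOpen_lt continuous_const Complex.continuous_re)).restrict_scalars ℝ
  have h2 := Complex.reCLM.contDiff.comp_contDiffOn
    (h1.comp (s := Ioi 0) Complex.ofRealCLM.contDiff.contDiffOn (fun s hs => by simpa using hs))
  refine Real.contDiff_exp.comp_contDiffOn (contDiffOn_const.mul (h2.congr fun s _ => ?_))
  simp only [Function.comp_apply, Complex.ofRealCLM_apply, Complex.reCLM_apply]
  rw [← Complex.ofReal_re (∫ x in Ioi d, laplaceIntegrand M P s x), ← integral_complex_ofReal]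
  simp [laplaceIntegrand]

lemma laplaceForm_pos (s : ℝ) : 0 < laplaceForm M lam P d s := Real.exp_pos _

lemma laplaceForm_le_one (hP : 0 < P) (hs : 0 ≤ s) (hd : 0 < d) :
    laplaceForm M lam P d s ≤ 1 := by
  rw [laplaceForm, Real.exp_le_one_iff]
  have h : 0 ≤ ∫ x in Ioi d, laplaceIntegrand M P s x :=
    setIntegral_nonneg measurableSet_Ioi fun x hx =>
      laplaceIntegrand_nonneg M hP hs (hd.trans hx)
  have : 0 ≤ 2 * Real.pi * lam * ∫ x in Ioi d, laplaceIntegrand M P s x := by positivity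
  linarith

lemma measurable_laplaceForm (s : ℝ) : Measurable fun d => laplaceForm M lam P d s := by
  have h : StronglyMeasurable fun d : ℝ => ∫ x, (Ioi d).indicator (laplaceIntegrand M P s) x := by
    refine StronglyMeasurable.integral_prod_right
      (f := fun d x : ℝ => (Ioi d).indicator (laplaceIntegrand M P s) x) ?_
    refine Measurable.stronglyMeasurable ?_
    exact Measurable.indicator ((measurable_laplaceIntegrand M).comp measurable_snd)
      (measurableSet_lt measurable_fst measurable_snd)
  simp_rw [integral_indicator measurableSet_Ioi] at h
  unfold laplaceForm
  have := h.measurable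
  fun_prop

/-- Fundamental theorem of calculus in the lower limit, based at `x / 2` to stay inside `(0, ∞)`,
where the pathloss is continuous. -/
lemma hasDerivAt_laplaceForm_dist (hP : 0 < P) (hs : 0 ≤ s) {x : ℝ} (hx : 0 < x) :
    HasDerivAt (fun d => laplaceForm M lam P d s)
      (laplaceForm M lam P x s * (2 * Real.pi * lam * laplaceIntegrand M P s x)) x := by
  have hcont : ContinuousOn (laplaceIntegrand M P s) (Ioi 0) := by
    refine continuousOn_id.mul (continuousOn_const.sub (continuousOn_const.div
      (continuousOn_const.add (continuousOn_const.mul M.continuousOn_pathloss)) fun y hy => ?_))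
    have := M.pathloss_pos hy
    positivity
  have hI : HasDerivAt (fun d => ∫ y in Ioi d, laplaceIntegrand M P s y)
      (-laplaceIntegrand M P s x) x := by
    have h1 : HasDerivAt (fun d => (∫ y in Ioi (x / 2), laplaceIntegrand M P s y) -
        ∫ y in (x / 2)..d, laplaceIntegrand M P s y) (-laplaceIntegrand M P s x) x := by
      refine HasDerivAt.const_sub _ (intervalIntegral.integral_hasDerivAt_right ?_ ?_
        (hcont.continuousAt (Ioi_mem_nhds hx)))
      · refine (hcont.mono ?_).intervalIntegrable
        rw [uIcc_of_le (by linarith)]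
        exact fun y hy => (half_pos hx).trans_le hy.1
      · exact (measurable_laplaceIntegrand M).stronglyMeasurable.stronglyMeasurableAtFilter
    refine h1.congr_of_eventuallyEq ?_
    filter_upwards [Ioi_mem_nhds (show x / 2 < x by linarith)] with d hd
    rw [← intervalIntegral.integral_Ioi_sub_Ioi
      (integrableOn_laplaceIntegrand M hP hs (half_pos hx)) (le_of_lt hd)]
    ring
  have h := (hI.const_mul (-2 * Real.pi * lam)).exp
  unfold laplaceForm
  exact h.congr_deriv (by ring)

/-- The probability density of the serving distance times the conditional Laplace transform of the
received power is the derivative of an explicit tail function. -/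
lemma lintegral_tail (hlam : 0 < lam) (hP : 0 < P) (hs : 0 ≤ s) (c : ℝ) {b : ℝ} (hb : 0 < b) :
    ∫⁻ x in Ioi b, ENNReal.ofReal (2 * Real.pi * lam * x *
        Real.exp (-(lam * Real.pi * (x ^ 2 - c ^ 2)))) *
        ENNReal.ofReal (1 / (1 + 2 * s * P * M.pathloss x)) *
        ENNReal.ofReal (laplaceForm M lam P x s) =
      ENNReal.ofReal (Real.exp (-(lam * Real.pi * (b ^ 2 - c ^ 2))) * laplaceForm M lam P b s) := by
  set T : ℝ → ℝ := fun x => Real.exp (-(lam * Real.pi * (x ^ 2 - c ^ 2))) * laplaceForm M lam P x s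
    with hT
  set T' : ℝ → ℝ := fun x => -(2 * Real.pi * lam * x *
    Real.exp (-(lam * Real.pi * (x ^ 2 - c ^ 2))) * (1 / (1 + 2 * s * P * M.pathloss x)) *
      laplaceForm M lam P x s) with hT'
  have hlam' : (0 : ℝ) < lam := hlam
  have hder : ∀ x, 0 < x → HasDerivAt T (T' x) x := by
    intro x hx
    have h1 : HasDerivAt (fun x : ℝ => Real.exp (-(lam * Real.pi * (x ^ 2 - c ^ 2))))
        (Real.exp (-(lam * Real.pi * (x ^ 2 - c ^ 2))) * (-(lam * Real.pi * (2 * x)))) x := by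
      have := ((((hasDerivAt_pow 2 x).sub_const (c ^ 2)).const_mul (lam * Real.pi)).neg).exp
      simpa using this
    have h2 := h1.mul (hasDerivAt_laplaceForm_dist M (lam := lam) hP hs hx)
    -- The factor `-2πλx` from the void probability and `2πλx(1 - 1/(1+u))` from the closed form add
    -- up to `-2πλx/(1+u)`, with `u = 2 s P l(x)`.
    refine h2.congr_deriv ?_
    simp only [hT', laplaceIntegrand]
    ring
  have hnonpos : ∀ x ∈ Ioi b, T' x ≤ 0 := by
    intro x hx
    have hx0 : 0 < x := hb.trans hx
    have := M.pathloss_pos hx0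
    have := laplaceForm_pos M (lam := lam) (P := P) (d := x) s
    simp only [hT']
    rw [neg_nonpos]
    positivity
  have hlim : Tendsto T atTop (𝓝 0) := by
    have h1 : Tendsto (fun x : ℝ => Real.exp (-(lam * Real.pi * (x ^ 2 - c ^ 2)))) atTop (𝓝 0) := by
      refine Real.tendsto_exp_neg_atTop_nhds_zero.comp
        (Tendsto.const_mul_atTop (by positivity) ?_)
      exact tendsto_atTop_add_const_right _ _ (tendsto_pow_atTop two_ne_zero)
    refine squeeze_zero' ?_ ?_ h1
    · exact Eventually.of_forall fun x => by
        have := laplaceForm_pos M (lam := lam) (P := P) (d := x) s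
        positivity
    · filter_upwards [eventually_gt_atTop 0] with x hx
      exact mul_le_of_le_one_right (Real.exp_pos _).le (laplaceForm_le_one M hP hs hx)
  have hcont : ContinuousWithinAt T (Ici b) b := (hder b hb).continuousAt.continuousWithinAt
  have hint := integrableOn_Ioi_deriv_of_nonpos hcont
    (fun x hx => hder x (hb.trans hx)) hnonpos hlim
  have hval := integral_Ioi_of_hasDerivAt_of_nonpos hcont
    (fun x hx => hder x (hb.trans hx)) hnonpos hlim
  have hval' : ∫ x in Ioi b, -T' x = T b := by rw [integral_neg, hval]; ring
  change _ = ENNReal.ofReal (T b)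
  rw [← hval', ofReal_integral_eq_lintegral_ofReal (f := fun x => -T' x) hint.neg
    ((ae_restrict_iff' measurableSet_Ioi).2 (ae_of_all _ fun x hx => by
      simpa using hnonpos x hx))]
  refine setLIntegral_congr_fun measurableSet_Ioi fun x hx => ?_
  have hx0 : 0 < x := hb.trans hx
  have := M.pathloss_pos hx0
  simp only [hT', neg_neg]
  rw [← ENNReal.ofReal_mul (by positivity), ← ENNReal.ofReal_mul (by positivity)]

end Laplace

/-! ### Radial images of planar measures -/

/-- Disc area is linear in the squared radius. This one computation serves both the positions in the
plane and the moduli of complex normal variables. -/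
lemma map_sq_norm {E : Type*} [NormedAddCommGroup E] [MeasurableSpace E] [BorelSpace E]
    (ν : Measure E) (hν : ∀ r : ℝ, 0 ≤ r →
      ν (Metric.ball 0 r) = ENNReal.ofReal (Real.pi * r ^ 2)) :
    ν.map (fun x => ‖x‖ ^ 2) =
      ENNReal.ofReal Real.pi • (volume : Measure ℝ).restrict (Ici 0) := by
  symm
  have : IsLocallyFiniteMeasure
      (ENNReal.ofReal Real.pi • (volume : Measure ℝ).restrict (Ici 0)) :=
    inferInstanceAs (IsLocallyFiniteMeasure
      ((Real.toNNReal Real.pi) • (volume : Measure ℝ).restrict (Ici 0)))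
  refine Measure.ext_of_Ico _ _ fun a b hab => ?_
  rw [Measure.smul_apply, Measure.restrict_apply measurableSet_Ico, Ico_inter_Ici, Real.volume_Ico,
    smul_eq_mul, Measure.map_apply (by fun_prop) measurableSet_Ico,
    ← ENNReal.ofReal_mul Real.pi_pos.le]
  have ha : 0 ≤ max a 0 := le_max_right _ _
  rcases le_or_gt b 0 with hb | hb
  · rw [ENNReal.ofReal_of_nonpos, eq_comm]
    · convert measure_empty (μ := ν)
      ext x
      simp only [mem_preimage, mem_Ico, mem_empty_iff_false, iff_false, not_and, not_lt]
      intro _; have := sq_nonneg ‖x‖; linarith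
    · exact mul_nonpos_of_nonneg_of_nonpos Real.pi_pos.le (by linarith)
  · have hset : (fun x : E => ‖x‖ ^ 2) ⁻¹' Ico a b =
        Metric.ball 0 (Real.sqrt b) \ Metric.ball 0 (Real.sqrt (max a 0)) := by
      ext x
      simp only [mem_preimage, mem_Ico, Set.mem_sdiff, Metric.mem_ball, dist_zero_right, not_lt]
      rw [Real.lt_sqrt (norm_nonneg x), Real.sqrt_le_left (norm_nonneg x), max_le_iff]
      have := sq_nonneg ‖x‖
      tauto
    have hab' : max a 0 ≤ b := max_le hab.le hb.le
    rw [hset, measure_sdiff (Metric.ball_subset_ball (Real.sqrt_le_sqrt hab'))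
      Metric.isOpen_ball.measurableSet.nullMeasurableSet (by rw [hν _ (Real.sqrt_nonneg _)]; simp),
      hν _ (Real.sqrt_nonneg _), hν _ (Real.sqrt_nonneg _), Real.sq_sqrt hb.le, Real.sq_sqrt ha,
      ← ENNReal.ofReal_sub _ (by positivity), mul_sub]

lemma map_sq_norm_plane : (volume : Measure Plane).map (fun x => ‖x‖ ^ 2) =
    ENNReal.ofReal Real.pi • (volume : Measure ℝ).restrict (Ici 0) := by
  refine map_sq_norm _ fun r hr => ?_
  rw [EuclideanSpace.volume_ball_fin_two, ENNReal.ofReal_mul Real.pi_pos.le,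
    ENNReal.ofReal_pow hr, ← NNReal.coe_real_pi, ENNReal.ofReal_coe_nnreal, mul_comm]

lemma map_sq_norm_complex : (volume : Measure ℂ).map (fun x => ‖x‖ ^ 2) =
    ENNReal.ofReal Real.pi • (volume : Measure ℝ).restrict (Ici 0) := by
  refine map_sq_norm _ fun r hr => ?_
  rw [Complex.volume_ball, ENNReal.ofReal_mul Real.pi_pos.le,
    ENNReal.ofReal_pow hr, ← NNReal.coe_real_pi, ENNReal.ofReal_coe_nnreal, mul_comm]

/-- The distance of a point at height difference `c` above the plane. -/
noncomputable def slant (c : ℝ) (x : Plane) : ℝ := Real.sqrt (‖x‖ ^ 2 + c ^ 2)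

@[fun_prop] lemma measurable_slant (c : ℝ) : Measurable (slant c) := by unfold slant; fun_prop

lemma le_slant (c : ℝ) (x : Plane) : c ≤ slant c x :=
  Real.le_sqrt_of_sq_le (by have := sq_nonneg ‖x‖; linarith)

/-- Polar coordinates, then the substitution `t = x² - c²` for the squared planar radius `t`. -/
lemma lintegral_slant {c : ℝ} (hc : 0 ≤ c) {f : ℝ → ℝ≥0∞} (hf : Measurable f) :
    ∫⁻ x : Plane, f (slant c x) = ∫⁻ x in Ici c, ENNReal.ofReal (2 * Real.pi * x) * f x := by
  have h1 : ∫⁻ x : Plane, f (slant c x) =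
      ∫⁻ t, f (Real.sqrt (t + c ^ 2)) ∂((volume : Measure Plane).map (fun x => ‖x‖ ^ 2)) :=
    (lintegral_map (f := fun t => f (Real.sqrt (t + c ^ 2))) (by fun_prop) (by fun_prop)).symm
  have himg : Ici (0 : ℝ) = (fun x : ℝ => x ^ 2 - c ^ 2) '' Ici c := by
    ext t
    simp only [mem_Ici, mem_image]
    constructor
    · intro ht
      refine ⟨Real.sqrt (t + c ^ 2), Real.le_sqrt_of_sq_le (by linarith), ?_⟩
      rw [Real.sq_sqrt (by positivity)]; ring
    · rintro ⟨x, hx, rfl⟩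
      nlinarith
  rw [h1, map_sq_norm_plane, lintegral_smul_measure, smul_eq_mul, himg,
    lintegral_image_eq_lintegral_abs_deriv_mul measurableSet_Ici
      (f' := fun x => 2 * x) (fun x _ => by
        have := ((hasDerivAt_pow 2 x).sub_const (c ^ 2)).hasDerivWithinAt (s := Ici c)
        simpa using this)
      (fun x hx y hy hxy => by
        simp only [sub_left_inj] at hxy
        exact (pow_left_inj₀ (hc.trans hx) (hc.trans hy) two_ne_zero).1 hxy),
    ← lintegral_const_mul _ (by fun_prop)]
  refine setLIntegral_congr_fun measurableSet_Ici fun x hx => ?_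
  have hx0 : 0 ≤ x := hc.trans hx
  rw [sub_add_cancel, Real.sqrt_sq hx0, abs_of_nonneg (by positivity), ← mul_assoc,
    ← ENNReal.ofReal_mul Real.pi_pos.le]
  congr 2; ring

/-! ### The serving distance and the other base stations -/

/-- The negative logarithm of the Laplace transform of the power received from a base station at
distance `x`. -/
noncomputable def logLoss {N : ℕ} (M : MultiSlope N) (P s x : ℝ) : ℝ≥0∞ :=
  ENNReal.ofReal (Real.log (1 + 2 * s * P * M.pathloss x))

@[fun_prop] lemma measurable_logLoss {N : ℕ} (M : MultiSlope N) (P s : ℝ) :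
    Measurable (logLoss M P s) := by unfold logLoss; fun_prop

lemma expNeg_logLoss {N : ℕ} (M : MultiSlope N) {P s x : ℝ} (hP : 0 < P) (hs : 0 ≤ s) (hx : 0 < x) :
    expNeg (logLoss M P s x) = ENNReal.ofReal (1 / (1 + 2 * s * P * M.pathloss x)) := by
  have := M.pathloss_pos hx
  have h : 0 ≤ 2 * s * P * M.pathloss x := by positivity
  rw [logLoss, expNeg_ofReal (Real.log_nonneg (by linarith)), Real.exp_neg, Real.exp_log
    (by linarith), one_div]

section Serving

variable {Ω : Type*} [MeasurableSpace Ω] {μ : Measure Ω} [IsProbabilityMeasure μ] {N : ℕ}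
  (M : MultiSlope N) {lam : ℝ≥0} {P c s b : ℝ} {X : ℕ → Ω → Plane}

omit [IsProbabilityMeasure μ] in
lemma IsPoissonProcess.measurable_dist3 (hX : IsPoissonProcess μ lam X) (i : ℕ) :
    Measurable (dist3 c X i) :=
  (measurable_slant c).comp (hX.measurable i)

omit [MeasurableSpace Ω] in
lemma le_dist3 (i : ℕ) (ω : Ω) : c ≤ dist3 c X i ω := le_slant c (X i ω)

/-- Below `b` the infinite weight makes the integrand 1, so the area of the excluded disc appears;
beyond `b` the integrand is `1 - 1 / (1 + 2 s P l)`. -/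
lemma lintegral_exclusion (hP : 0 < P) (hc : 0 < c) (hs : 0 ≤ s) (hb : c ≤ b) :
    ∫⁻ x : Plane, (1 - expNeg ((Iio b).piecewise (fun _ => ∞) (logLoss M P s) (slant c x))) =
      ENNReal.ofReal (Real.pi * (b ^ 2 - c ^ 2) +
        2 * Real.pi * ∫ x in Ioi b, laplaceIntegrand M P s x) := by
  classical
  have hb0 : 0 < b := hc.trans_le hb
  have hm : Measurable ((Iio b).piecewise (fun _ => ∞) (logLoss M P s)) :=
    Measurable.piecewise measurableSet_Iio measurable_const (by fun_prop)
  rw [lintegral_slant (f := fun x => 1 - expNeg ((Iio b).piecewise (fun _ => ∞) (logLoss M P s) x))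
    hc.le (by fun_prop), ← Ico_union_Ici_eq_Ici hb, lintegral_union measurableSet_Ici
    (by rw [Set.disjoint_left]; exact fun x hx hx' => absurd hx.2 (not_lt.2 hx'))]
  have hI : 0 ≤ ∫ x in Ioi b, laplaceIntegrand M P s x :=
    setIntegral_nonneg measurableSet_Ioi fun x hx => laplaceIntegrand_nonneg M hP hs (hb0.trans hx)
  rw [ENNReal.ofReal_add (mul_nonneg Real.pi_pos.le (by nlinarith)) (by positivity)]
  congr 1
  · have h1 : ∫⁻ x in Ico c b, ENNReal.ofReal (2 * Real.pi * x) *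
        (1 - expNeg ((Iio b).piecewise (fun _ => ∞) (logLoss M P s) x)) =
        ∫⁻ x in Ico c b, ENNReal.ofReal (2 * Real.pi * x) := by
      refine setLIntegral_congr_fun measurableSet_Ico fun x hx => ?_
      rw [Set.piecewise_eq_of_mem _ _ _ (show x ∈ Iio b from hx.2)]; simp
    rw [h1, restrict_Ico_eq_restrict_Ioc, ← ofReal_integral_eq_lintegral_ofReal]
    · rw [← intervalIntegral.integral_of_le hb, intervalIntegral.integral_const_mul, integral_id]
      congr 1; ring
    · exact (Continuous.integrableOn_Icc (by fun_prop)).mono_set Ioc_subset_Icc_self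
    · refine (ae_restrict_iff' measurableSet_Ioc).2 (ae_of_all _ fun x hx => ?_)
      have : 0 < x := hc.trans hx.1
      simp only [Pi.zero_apply]; positivity
  · rw [← restrict_Ioi_eq_restrict_Ici, ← integral_const_mul, ofReal_integral_eq_lintegral_ofReal
      ((integrableOn_laplaceIntegrand M hP hs hb0).const_mul _)]
    · refine setLIntegral_congr_fun measurableSet_Ioi fun x hx => ?_
      have hx0 : 0 < x := hb0.trans hx
      have hl := M.pathloss_pos hx0
      have hb' : x ∉ Iio b := fun h => lt_asymm (mem_Iio.1 h) (mem_Ioi.1 hx)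
      rw [Set.piecewise_eq_of_notMem _ _ _ hb', expNeg_logLoss M hP hs hx0, ← ENNReal.ofReal_one,
        ← ENNReal.ofReal_sub _ (by positivity), ← ENNReal.ofReal_mul (by positivity),
        laplaceIntegrand]
      congr 1; ring
    · exact (ae_restrict_iff' measurableSet_Ioi).2 (ae_of_all _ fun x hx =>
        mul_nonneg (by positivity) (laplaceIntegrand_nonneg M hP hs (hb0.trans hx)))

/-- The Laplace functional on the event that no base station is nearer than `b`. -/
lemma IsPoissonProcess.lintegral_expNeg_exclusion (hX : IsPoissonProcess μ lam X) (hP : 0 < P)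
    (hc : 0 < c) (hs : 0 ≤ s) (hb : c ≤ b) :
    ∫⁻ ω, {ω | ∀ i, b ≤ dist3 c X i ω}.indicator
        (fun ω => expNeg (∑' i, logLoss M P s (dist3 c X i ω))) ω ∂μ =
      ENNReal.ofReal (Real.exp (-(lam * Real.pi * (b ^ 2 - c ^ 2))) * laplaceForm M lam P b s) := by
  classical
  have hb0 : 0 < b := hc.trans_le hb
  have hm : Measurable ((Iio b).piecewise (fun _ => ∞) (logLoss M P s)) :=
    Measurable.piecewise measurableSet_Iio measurable_const (by fun_prop)
  -- The infinite weight below `b` annihilates every configuration with a station there, so it plays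
  -- the part of the indicator.
  have h := hX.lintegral_expNeg_tsum
    (φ := fun x => (Iio b).piecewise (fun _ => ∞) (logLoss M P s) (slant c x)) (by fun_prop)
    (by rw [lintegral_exclusion M hP hc hs hb]; exact ENNReal.ofReal_ne_top)
  have hI : 0 ≤ ∫ x in Ioi b, laplaceIntegrand M P s x :=
    setIntegral_nonneg measurableSet_Ioi fun x hx => laplaceIntegrand_nonneg M hP hs (hb0.trans hx)
  have hbc : 0 ≤ b ^ 2 - c ^ 2 := by nlinarith
  rw [lintegral_exclusion M hP hc hs hb, ← ENNReal.ofReal_coe_nnreal, ← ENNReal.ofReal_mul (NNReal.coe_nonneg lam),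
    expNeg_ofReal (by positivity)] at h
  rw [laplaceForm, ← Real.exp_add]
  have harg : -(lam * Real.pi * (b ^ 2 - c ^ 2)) +
      -2 * Real.pi * lam * ∫ x in Ioi b, laplaceIntegrand M P s x =
      -(lam * (Real.pi * (b ^ 2 - c ^ 2) +
        2 * Real.pi * ∫ x in Ioi b, laplaceIntegrand M P s x)) := by ring
  rw [harg]
  refine Eq.trans (lintegral_congr fun ω => ?_) h
  by_cases hω : ∀ i, b ≤ dist3 c X i ω
  · rw [indicator_of_mem (show ω ∈ {ω | ∀ i, b ≤ dist3 c X i ω} from hω)]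
    congr 1
    refine tsum_congr fun i => ?_
    have hi : slant c (X i ω) ∉ Iio b := not_lt.2 (hω i)
    rw [Set.piecewise_eq_of_notMem _ _ _ hi]
    rfl
  · rw [indicator_of_notMem (show ω ∉ {ω | ∀ i, b ≤ dist3 c X i ω} from hω)]
    push Not at hω
    obtain ⟨i, hi⟩ := hω
    have hi' : slant c (X i ω) ∈ Iio b := hi
    rw [ENNReal.tsum_eq_top_of_eq_top ⟨i, Set.piecewise_eq_of_mem _ _ _ hi'⟩, expNeg_top]

end Serving

/-! ### The law of the serving distance, and the remaining stations given that distance. -/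

section Serving

variable {Ω : Type*} [MeasurableSpace Ω] {μ : Measure Ω} [IsProbabilityMeasure μ] {N : ℕ}
  (M : MultiSlope N) {lam : ℝ≥0} {P c s b : ℝ} {X : ℕ → Ω → Plane}

/-- The tail of the serving distance, weighted with the Laplace transform of the total received
power. -/
lemma IsPoissonProcess.setLIntegral_expNeg_tsum (hX : IsPoissonProcess μ lam X)
    (hnear : ∀ᵐ ω ∂μ, ∀ i, ‖X 0 ω‖ ≤ ‖X i ω‖) (hP : 0 < P) (hc : 0 < c) (hs : 0 ≤ s)
    (hb : c ≤ b) :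
    ∫⁻ ω in dist3 c X 0 ⁻¹' Ici b, expNeg (∑' i, logLoss M P s (dist3 c X i ω)) ∂μ =
      ENNReal.ofReal (Real.exp (-(lam * Real.pi * (b ^ 2 - c ^ 2))) * laplaceForm M lam P b s) := by
  rw [← hX.lintegral_expNeg_exclusion M hP hc hs hb,
    ← lintegral_indicator (hX.measurable_dist3 0 measurableSet_Ici)]
  refine lintegral_congr_ae ?_
  filter_upwards [hnear] with ω hω
  have hiff : ω ∈ dist3 c X 0 ⁻¹' Ici b ↔ ω ∈ {ω | ∀ i, b ≤ dist3 c X i ω} := by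
    refine ⟨fun h i => le_trans h ?_, fun h => h 0⟩
    exact Real.sqrt_le_sqrt (by gcongr; exact hω i)
  by_cases h : ω ∈ dist3 c X 0 ⁻¹' Ici b
  · rw [indicator_of_mem h, indicator_of_mem (hiff.1 h)]
  · rw [indicator_of_notMem h, indicator_of_notMem (mt hiff.2 h)]

lemma laplaceForm_zero (d : ℝ) : laplaceForm M lam P d 0 = 1 := by
  simp [laplaceForm, laplaceIntegrand]

/-- Finite measures on the real line that live on `[c, ∞)` are determined by their tails there. -/
lemma ext_of_Ici_of_le {ν ν' : Measure ℝ} [IsFiniteMeasure ν]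
    (hν : ν (Iio c) = 0) (hν' : ν' (Iio c) = 0) (h : ∀ b, c ≤ b → ν (Ici b) = ν' (Ici b)) :
    ν = ν' := by
  refine Measure.ext_of_Ici _ _ fun a => ?_
  have aux : ∀ ρ : Measure ℝ, ρ (Iio c) = 0 → ρ (Ici a) = ρ (Ici (max a c)) := by
    intro ρ hρ
    refine le_antisymm ?_ (measure_mono (Ici_subset_Ici.2 (le_max_left _ _)))
    have : Ici a ⊆ Iio c ∪ Ici (max a c) := by
      intro x hx
      rcases lt_or_ge x c with h | h
      · exact Or.inl h
      · exact Or.inr (max_le hx h)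
    refine (measure_mono this).trans ((measure_union_le _ _).trans ?_)
    rw [hρ, zero_add]
  rw [aux ν hν, aux ν' hν', h _ (le_max_right _ _)]

/-- The law of the serving distance. -/
lemma IsPoissonProcess.map_dist3_zero (hX : IsPoissonProcess μ lam X) (hlam : 0 < lam)
    (hnear : ∀ᵐ ω ∂μ, ∀ i, ‖X 0 ω‖ ≤ ‖X i ω‖) (hc : 0 < c) :
    μ.map (dist3 c X 0) = (volume.restrict (Ici c)).withDensity fun x =>
      ENNReal.ofReal (2 * Real.pi * lam * x * Real.exp (-(lam * Real.pi * (x ^ 2 - c ^ 2)))) := by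
  have hD := hX.measurable_dist3 (c := c) 0
  -- any pathloss model will do, since it does not matter at `s = 0`
  let M₀ : MultiSlope 1 := ⟨fun _ => 3, fun _ => 0, one_pos, by norm_num, fun _ _ => le_rfl,
    by norm_num, rfl, fun n hn => absurd hn (by omega)⟩
  refine ext_of_Ici_of_le (c := c) ?_ ?_ fun b hb => ?_
  · rw [Measure.map_apply hD measurableSet_Iio]
    convert measure_empty (μ := μ)
    exact eq_empty_of_forall_notMem fun ω hω => absurd (le_dist3 (c := c) (X := X) 0 ω) (not_le.2 hω)
  · rw [withDensity_apply _ measurableSet_Iio, Measure.restrict_restrict measurableSet_Iio]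
    have : Iio c ∩ Ici c = ∅ := by ext x; simp
    rw [this]; simp
  · have h1 := hX.setLIntegral_expNeg_tsum M₀ hnear one_pos hc le_rfl hb
    have h2 := lintegral_tail M₀ hlam one_pos le_rfl c (hc.trans_le hb)
    rw [Measure.map_apply hD measurableSet_Ici, withDensity_apply _ measurableSet_Ici,
      Measure.restrict_restrict measurableSet_Ici, inter_eq_left.2 (Ici_subset_Ici.2 hb),
      ← restrict_Ioi_eq_restrict_Ici]
    simp only [laplaceForm_zero, mul_one, mul_zero, zero_mul, add_zero, div_one, ENNReal.ofReal_one,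
      logLoss, Real.log_one, ENNReal.ofReal_zero, tsum_zero, expNeg_zero, lintegral_const,
      Measure.restrict_apply MeasurableSet.univ, univ_inter, one_mul] at h1 h2
    rw [h1, h2]

/-- Given the serving distance, the Laplace functional of the other base stations has the closed
form `laplaceForm`. -/
lemma IsPoissonProcess.setLIntegral_expNeg_tsum_succ (hX : IsPoissonProcess μ lam X)
    (hlam : 0 < lam) (hnear : ∀ᵐ ω ∂μ, ∀ i, ‖X 0 ω‖ ≤ ‖X i ω‖) (hP : 0 < P) (hc : 0 < c)
    (hs : 0 ≤ s) {B : Set ℝ} (hB : MeasurableSet B) :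
    ∫⁻ ω in dist3 c X 0 ⁻¹' B, expNeg (∑' i, logLoss M P s (dist3 c X (i + 1) ω)) ∂μ =
      ∫⁻ ω in dist3 c X 0 ⁻¹' B, ENNReal.ofReal (laplaceForm M lam P (dist3 c X 0 ω) s) ∂μ := by
  have hD := hX.measurable_dist3 (c := c)
  have hD0 := hD 0
  have hpos : ∀ i ω, 0 < dist3 c X i ω := fun i ω => hc.trans_le (le_dist3 i ω)
  set g : ℝ → ℝ≥0∞ := fun x => expNeg (logLoss M P s x) with hg
  have hgm : Measurable g := by fun_prop
  have hLm : Measurable fun x => ENNReal.ofReal (laplaceForm M lam P x s) :=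
    (measurable_laplaceForm M s).ennreal_ofReal
  set Y : Ω → ℝ≥0∞ := fun ω => expNeg (∑' i, logLoss M P s (dist3 c X (i + 1) ω)) with hY
  have hYm : Measurable Y := measurable_expNeg.comp
    (Measurable.tsum fun i => (measurable_logLoss M P s).comp (hD (i + 1)))
  -- With the factor of station 0 restored, the product runs over all stations, and its integrals
  -- over the events `b ≤ dist3 c X 0` are known.
  have hgY : ∀ ω, g (dist3 c X 0 ω) * Y ω = expNeg (∑' i, logLoss M P s (dist3 c X i ω)) := by
    intro ω
    rw [tsum_eq_zero_add' ENNReal.summable, expNeg_add]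
  set ν := (μ.withDensity fun ω => g (dist3 c X 0 ω) * Y ω).map (dist3 c X 0) with hν
  set ν' := (μ.withDensity fun ω => g (dist3 c X 0 ω) *
    ENNReal.ofReal (laplaceForm M lam P (dist3 c X 0 ω) s)).map (dist3 c X 0) with hν'
  have hempty : dist3 c X 0 ⁻¹' Iio c = ∅ :=
    eq_empty_of_forall_notMem fun ω hω => absurd (le_dist3 (c := c) (X := X) 0 ω) (not_le.2 hω)
  have : IsFiniteMeasure (μ.withDensity fun ω => g (dist3 c X 0 ω) * Y ω) := by
    refine isFiniteMeasure_withDensity (ne_top_of_le_ne_top (b := 1) (by simp) ?_)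
    refine (lintegral_mono fun ω => ?_).trans (by simp : ∫⁻ _, 1 ∂μ ≤ 1)
    rw [hgY]; exact expNeg_le_one _
  have heq : ν = ν' := by
    refine ext_of_Ici_of_le (c := c) ?_ ?_ fun b hb => ?_
    · rw [hν, Measure.map_apply hD0 measurableSet_Iio, hempty, measure_empty]
    · rw [hν', Measure.map_apply hD0 measurableSet_Iio, hempty, measure_empty]
    · rw [hν, hν', Measure.map_apply hD0 measurableSet_Ici, Measure.map_apply hD0 measurableSet_Ici,
        withDensity_apply _ (hD0 measurableSet_Ici), withDensity_apply _ (hD0 measurableSet_Ici)]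
      simp_rw [hgY]
      rw [hX.setLIntegral_expNeg_tsum M hnear hP hc hs hb,
        ← setLIntegral_map (f := fun x => g x * ENNReal.ofReal (laplaceForm M lam P x s))
          measurableSet_Ici (by fun_prop) hD0, hX.map_dist3_zero hlam hnear hc,
        restrict_withDensity measurableSet_Ici, Measure.restrict_restrict measurableSet_Ici,
        inter_eq_left.2 (Ici_subset_Ici.2 hb), ← restrict_Ioi_eq_restrict_Ici,
        lintegral_withDensity_eq_lintegral_mul _ (by fun_prop) (by fun_prop),
        ← lintegral_tail M hlam hP hs c (hc.trans_le hb)]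
      refine setLIntegral_congr_fun measurableSet_Ioi fun x hx => ?_
      have hx0 : 0 < x := (hc.trans_le hb).trans hx
      simp only [Pi.mul_apply, hg]
      rw [expNeg_logLoss M hP hs hx0, mul_assoc]
  -- The factor of station 0 depends only on the serving distance and is neither 0 nor infinite, so
  -- it can be divided out.
  have hdiv : ∀ (Z : Ω → ℝ≥0∞), Measurable Z →
      ∫⁻ x in B, (g x)⁻¹ ∂((μ.withDensity fun ω => g (dist3 c X 0 ω) * Z ω).map (dist3 c X 0)) =
      ∫⁻ ω in dist3 c X 0 ⁻¹' B, Z ω ∂μ := by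
    intro Z hZ
    rw [setLIntegral_map hB (by fun_prop) hD0, restrict_withDensity (hD0 hB),
      lintegral_withDensity_eq_lintegral_mul _ (by fun_prop) (by fun_prop)]
    refine lintegral_congr fun ω => ?_
    simp only [Pi.mul_apply, hg]
    rw [mul_right_comm, ENNReal.mul_inv_cancel (expNeg_ne_zero (by simp [logLoss]))
      (expNeg_ne_top _), one_mul]
  rw [← hdiv Y hYm, ← hdiv (fun ω => ENNReal.ofReal (laplaceForm M lam P (dist3 c X 0 ω) s))
    (hLm.comp hD0)]
  exact congrArg (fun ρ : Measure ℝ => ∫⁻ x in B, (g x)⁻¹ ∂ρ) heq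

end Serving

/-! ### The exponential law -/

/-- The exponential law with rate `r`. -/
noncomputable def expLaw (r : ℝ) : Measure ℝ :=
  (volume.restrict (Ioi 0)).withDensity fun x => ENNReal.ofReal (r * Real.exp (-(r * x)))

lemma lintegral_exp_Ioi {r k : ℝ} (hr : 0 ≤ r) (hk : 0 < k) (a : ℝ) :
    ∫⁻ x in Ioi a, ENNReal.ofReal (r * Real.exp (-(k * x))) =
      ENNReal.ofReal (r / k * Real.exp (-(k * a))) := by
  have h1 := integrableOn_exp_mul_Ioi (a := -k) (by linarith) a
  have h2 := integral_exp_mul_Ioi (a := -k) (by linarith) a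
  simp only [neg_mul] at h1 h2
  rw [← ofReal_integral_eq_lintegral_ofReal (h1.const_mul r)
    (ae_of_all _ fun x => by simp only [Pi.zero_apply]; positivity), integral_const_mul, h2]
  congr 1; field_simp

lemma lintegral_expLaw (r : ℝ) {f : ℝ → ℝ≥0∞} (hf : Measurable f) :
    ∫⁻ x, f x ∂expLaw r =
      ∫⁻ x in Ioi 0, ENNReal.ofReal (r * Real.exp (-(r * x))) * f x := by
  rw [expLaw, lintegral_withDensity_eq_lintegral_mul _ (by fun_prop) hf]
  rfl

lemma isProbabilityMeasure_expLaw {r : ℝ} (hr : 0 < r) : IsProbabilityMeasure (expLaw r) := by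
  constructor
  rw [expLaw, withDensity_apply _ MeasurableSet.univ, Measure.restrict_univ,
    lintegral_exp_Ioi hr.le hr]
  simp [hr.ne']

lemma lintegral_expNeg_expLaw {r c : ℝ} (hr : 0 < r) (hc : 0 ≤ c) :
    ∫⁻ x, expNeg (ENNReal.ofReal (c * x)) ∂expLaw r = ENNReal.ofReal (1 / (1 + c / r)) := by
  rw [lintegral_expLaw r (by fun_prop)]
  have : ∀ x ∈ Ioi (0 : ℝ), ENNReal.ofReal (r * Real.exp (-(r * x))) *
      expNeg (ENNReal.ofReal (c * x)) = ENNReal.ofReal (r * Real.exp (-((r + c) * x))) := by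
    intro x hx
    have hx0 : 0 < x := hx
    rw [expNeg_ofReal (by positivity), ← ENNReal.ofReal_mul (by positivity), mul_assoc,
      ← Real.exp_add]
    congr 3; ring
  rw [setLIntegral_congr_fun measurableSet_Ioi this, lintegral_exp_Ioi hr.le (by positivity)]
  congr 1
  simp only [mul_zero, neg_zero, Real.exp_zero]
  field_simp

lemma lintegral_ofReal_expLaw_ne_top {r : ℝ} (hr : 0 < r) :
    ∫⁻ x, ENNReal.ofReal x ∂expLaw r ≠ ∞ := by
  rw [lintegral_expLaw r (by fun_prop)]
  have h : ∫⁻ x in Ioi (0 : ℝ), ENNReal.ofReal (r * Real.exp (-(r * x))) * ENNReal.ofReal x ≤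
      ∫⁻ x in Ioi (0 : ℝ), ENNReal.ofReal (2 * Real.exp (-(r / 2 * x))) := by
    refine setLIntegral_mono' measurableSet_Ioi fun x hx => ?_
    have hx0 : 0 < x := hx
    rw [← ENNReal.ofReal_mul (by positivity)]
    refine ENNReal.ofReal_le_ofReal ?_
    -- Half of the exponential rate is spent on absorbing the factor `x`.
    have h1 : r / 2 * x ≤ Real.exp (r / 2 * x) := (by linarith : r / 2 * x ≤ r / 2 * x + 1).trans
      (Real.add_one_le_exp _)
    have h2 : Real.exp (-(r * x)) * Real.exp (r / 2 * x) = Real.exp (-(r / 2 * x)) := by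
      rw [← Real.exp_add]; congr 1; ring
    calc r * Real.exp (-(r * x)) * x = 2 * (Real.exp (-(r * x)) * (r / 2 * x)) := by ring
      _ ≤ 2 * (Real.exp (-(r * x)) * Real.exp (r / 2 * x)) := by gcongr
      _ = _ := by rw [h2]
  refine ne_top_of_le_ne_top ?_ h
  rw [lintegral_exp_Ioi (by norm_num) (by positivity)]
  exact ENNReal.ofReal_ne_top

/-- The tail of the Erlang law. -/
noncomputable def erlangTail (r : ℝ) (n : ℕ) (y : ℝ) : ℝ :=
  Real.exp (-(r * y)) * ∑ k ∈ Finset.range n, (r * y) ^ k / k.factorial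

lemma erlangTail_nonneg {r : ℝ} (hr : 0 < r) (n : ℕ) {y : ℝ} (hy : 0 ≤ y) :
    0 ≤ erlangTail r n y := by
  unfold erlangTail; positivity

lemma erlangTail_le_one {r : ℝ} (hr : 0 < r) (n : ℕ) {y : ℝ} (hy : 0 ≤ y) :
    erlangTail r n y ≤ 1 := by
  unfold erlangTail
  have h := Real.sum_le_exp_of_nonneg (mul_nonneg hr.le hy) n
  calc _ ≤ Real.exp (-(r * y)) * Real.exp (r * y) := by gcongr
    _ = 1 := by rw [← Real.exp_add]; simp

/-- Renewal equation: either the first summand exceeds `y`, or it equals some `x ≤ y` and the others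
exceed `y - x`. The exponentials merge into `exp (-(r * y))`, leaving integrals of powers. -/
lemma erlangTail_succ {r : ℝ} (n : ℕ) (y : ℝ) :
    erlangTail r (n + 1) y = Real.exp (-(r * y)) +
      ∫ x in (0 : ℝ)..y, r * Real.exp (-(r * x)) * erlangTail r n (y - x) := by
  have h1 : ∀ x, r * Real.exp (-(r * x)) * erlangTail r n (y - x) =
      ∑ k ∈ Finset.range n, Real.exp (-(r * y)) * (r ^ (k + 1) / k.factorial) * (y - x) ^ k := by
    intro x
    rw [erlangTail, mul_assoc, ← mul_assoc (Real.exp _) (Real.exp _), ← Real.exp_add,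
      show -(r * x) + -(r * (y - x)) = -(r * y) by ring, Finset.mul_sum, Finset.mul_sum]
    refine Finset.sum_congr rfl fun k _ => ?_
    rw [mul_pow, pow_succ]; ring
  simp_rw [h1]
  rw [intervalIntegral.integral_finsetSum fun k _ =>
    (Continuous.intervalIntegrable (by fun_prop) _ _)]
  rw [erlangTail, Finset.sum_range_succ']
  simp only [pow_zero, Nat.factorial_zero, Nat.cast_one, div_one, mul_add, mul_one]
  rw [add_comm, Finset.mul_sum]
  congr 1
  refine Finset.sum_congr rfl fun k _ => ?_
  rw [intervalIntegral.integral_const_mul,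
    intervalIntegral.integral_comp_sub_left (fun x => x ^ k) y, integral_pow, Nat.factorial_succ,
    mul_pow]
  push_cast
  rw [sub_self, sub_zero, zero_pow (by omega), sub_zero]
  field_simp

/-- The sum of `n` independent exponential variables follows the Erlang law. -/
lemma pi_expLaw_sum_gt {r : ℝ} (hr : 0 < r) (n : ℕ) {y : ℝ} (hy : 0 ≤ y) :
    Measure.pi (fun _ : Fin n => expLaw r) {x | y < ∑ i, x i} =
      ENNReal.ofReal (erlangTail r n y) := by
  have := isProbabilityMeasure_expLaw hr
  induction n generalizing y with
  | zero => simp [erlangTail, hy.not_gt]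
  | succ n ih =>
    have hmp := measurePreserving_piFinSuccAbove (fun _ : Fin (n + 1) => expLaw r) 0
    have hms : MeasurableSet {p : ℝ × (Fin n → ℝ) | y < p.1 + ∑ i, p.2 i} :=
      measurableSet_lt measurable_const (by fun_prop)
    have hset : {x : Fin (n + 1) → ℝ | y < ∑ i, x i} =
        (MeasurableEquiv.piFinSuccAbove (fun _ => ℝ) 0) ⁻¹'
          {p : ℝ × (Fin n → ℝ) | y < p.1 + ∑ i, p.2 i} := by
      ext x
      simp [Fin.sum_univ_succ, MeasurableEquiv.piFinSuccAbove, Fin.insertNthEquiv, Fin.tail]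
    rw [hset, hmp.measure_preimage hms.nullMeasurableSet, Measure.prod_apply hms]
    rw [lintegral_expLaw r (measurable_measure_prodMk_left hms),
      ← Ioc_union_Ioi_eq_Ioi hy, lintegral_union measurableSet_Ioi
        (by rw [Set.disjoint_left]; exact fun x hx hx' => absurd hx.2 (not_le.2 hx'))]
    have h1 : ∀ x ∈ Ioc 0 y, ENNReal.ofReal (r * Real.exp (-(r * x))) *
        Measure.pi (fun _ : Fin n => expLaw r)
          (Prod.mk x ⁻¹' {p : ℝ × (Fin n → ℝ) | y < p.1 + ∑ i, p.2 i}) =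
        ENNReal.ofReal (r * Real.exp (-(r * x)) * erlangTail r n (y - x)) := by
      intro x hx
      have : Prod.mk x ⁻¹' {p : ℝ × (Fin n → ℝ) | y < p.1 + ∑ i, p.2 i} =
          {z | y - x < ∑ i, z i} := by
        ext z; simp [sub_lt_iff_lt_add']
      rw [this, ih (sub_nonneg.2 hx.2), ← ENNReal.ofReal_mul (by positivity)]
    -- Once the first summand exceeds `y`, positivity of the others makes the event almost sure.
    have hpos : ∀ᵐ z ∂Measure.pi (fun _ : Fin n => expLaw r), ∀ i, 0 < z i := by
      rw [ae_all_iff]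
      intro i
      have h0 : ∀ᵐ t ∂expLaw r, 0 < t :=
        (withDensity_absolutelyContinuous _ _).ae_le (ae_restrict_mem measurableSet_Ioi)
      exact (Measure.quasiMeasurePreserving_eval (μ := fun _ : Fin n => expLaw r) i).ae h0
    have h2 : ∀ x ∈ Ioi y, ENNReal.ofReal (r * Real.exp (-(r * x))) *
        Measure.pi (fun _ : Fin n => expLaw r)
          (Prod.mk x ⁻¹' {p : ℝ × (Fin n → ℝ) | y < p.1 + ∑ i, p.2 i}) =
        ENNReal.ofReal (r * Real.exp (-(r * x))) := by
      intro x hx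
      have : Measure.pi (fun _ : Fin n => expLaw r)
          (Prod.mk x ⁻¹' {p : ℝ × (Fin n → ℝ) | y < p.1 + ∑ i, p.2 i}) = 1 := by
        rw [prob_compl_eq_zero_iff₀ ?_ |>.symm]
        · refine measure_mono_null (fun z hz => ?_) hpos
          simp only [mem_compl_iff, mem_preimage, Set.mem_ofPred_eq] at hz ⊢
          intro h
          exact hz (lt_add_of_lt_of_nonneg hx (Finset.sum_nonneg fun i _ => (h i).le))
        · exact (measurable_prodMk_left hms).nullMeasurableSet
      rw [this, mul_one]
    rw [setLIntegral_congr_fun measurableSet_Ioc h1, setLIntegral_congr_fun measurableSet_Ioi h2,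
      lintegral_exp_Ioi hr.le hr, div_self hr.ne', one_mul, erlangTail_succ,
      ← ofReal_integral_eq_lintegral_ofReal, ← intervalIntegral.integral_of_le hy,
      ← ENNReal.ofReal_add, add_comm]
    · exact intervalIntegral.integral_nonneg hy fun x hx =>
        mul_nonneg (by positivity) (erlangTail_nonneg hr n (sub_nonneg.2 hx.2))
    · positivity
    · exact (Continuous.integrableOn_Icc (by unfold erlangTail; fun_prop)).mono_set
        Ioc_subset_Icc_self
    · exact (ae_restrict_iff' measurableSet_Ioc).2 (ae_of_all _ fun x hx =>
        mul_nonneg (by positivity) (erlangTail_nonneg hr n (sub_nonneg.2 hx.2)))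

/-! ### The complex normal law -/

section ComplexNormal

variable {v : ℝ≥0}

instance : IsProbabilityMeasure (complexNormal v) :=
  Measure.isProbabilityMeasure_map (Complex.measurableEquivRealProd.symm.measurable.aemeasurable)

/-- The density depends on the modulus only, so the law of `‖z‖ ^ 2` follows from the radial image
of Lebesgue measure. -/
lemma complexNormal_eq_withDensity (hv : 0 < v) :
    complexNormal v = (volume : Measure ℂ).withDensity fun z =>
      ENNReal.ofReal ((2 * Real.pi * v)⁻¹ * Real.exp (-((2 * (v : ℝ))⁻¹ * ‖z‖ ^ 2))) := by
  have hv' : (0 : ℝ) < v := hv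
  have h1 : (gaussianReal 0 v).prod (gaussianReal 0 v) =
      (volume : Measure (ℝ × ℝ)).withDensity fun p =>
        ENNReal.ofReal ((2 * Real.pi * v)⁻¹ *
          Real.exp (-((2 * (v : ℝ))⁻¹ * (p.1 ^ 2 + p.2 ^ 2)))) := by
    rw [gaussianReal_of_var_ne_zero _ hv.ne', prod_withDensity (by fun_prop) (by fun_prop)]
    congr 1
    ext p
    simp only [gaussianPDF, gaussianPDFReal]
    rw [← ENNReal.ofReal_mul (by positivity)]
    congr 1
    rw [mul_mul_mul_comm, ← mul_inv, Real.mul_self_sqrt (by positivity), ← Real.exp_add]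
    congr 2
    field_simp
    ring
  have hmp := Complex.volume_preserving_equiv_real_prod.symm
  change Measure.map Complex.measurableEquivRealProd.symm _ = _
  rw [h1]
  ext s hs
  rw [Measure.map_apply (MeasurableEquiv.measurable _) hs, withDensity_apply _
    (MeasurableEquiv.measurable _ hs), withDensity_apply _ hs, ← hmp.setLIntegral_comp_preimage hs
    (by fun_prop)]
  refine lintegral_congr fun p => ?_
  rw [Complex.sq_norm, Complex.normSq_apply]
  simp [Complex.measurableEquivRealProd_symm_apply, sq]

/-- The squared modulus of a complex normal variable is exponential. -/
lemma map_sq_norm_complexNormal (hv : 0 < v) :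
    (complexNormal v).map (fun z => ‖z‖ ^ 2) = expLaw (2 * (v : ℝ))⁻¹ := by
  have hv' : (0 : ℝ) < v := hv
  ext s hs
  rw [complexNormal_eq_withDensity hv, Measure.map_apply (by fun_prop) hs,
    withDensity_apply _ ((by fun_prop : Measurable fun z : ℂ => ‖z‖ ^ 2) hs),
    ← setLIntegral_map (f := fun t => ENNReal.ofReal ((2 * Real.pi * v)⁻¹ *
      Real.exp (-((2 * (v : ℝ))⁻¹ * t)))) (g := fun z : ℂ => ‖z‖ ^ 2) hs (by fun_prop)
      (by fun_prop), map_sq_norm_complex, Measure.restrict_smul, lintegral_smul_measure,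
    smul_eq_mul, ← lintegral_const_mul _ (by fun_prop), expLaw, withDensity_apply _ hs,
    restrict_Ioi_eq_restrict_Ici]
  refine lintegral_congr fun t => ?_
  rw [← ENNReal.ofReal_mul Real.pi_pos.le, ← mul_assoc]
  congr 2
  field_simp

lemma complexNormal_singleton (hv : 0 < v) (z : ℂ) : complexNormal v {z} = 0 := by
  rw [complexNormal_eq_withDensity hv]
  exact withDensity_absolutelyContinuous _ _ (measure_singleton z)

/-- Dependence on `‖t‖` alone expresses rotation invariance; the stability of the law under unit
combinations rests on it. -/
lemma charFun_complexNormal (t : ℂ) :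
    charFun (complexNormal v) t = Complex.exp (-((v * ‖t‖ ^ 2 / 2 : ℝ) : ℂ)) := by
  have hm : Measurable fun p : ℝ × ℝ => (⟨p.1, p.2⟩ : ℂ) :=
    Complex.measurableEquivRealProd.symm.measurable
  rw [charFun_apply, complexNormal, integral_map hm.aemeasurable
    (by fun_prop : Measurable _).aestronglyMeasurable]
  have h : ∀ p : ℝ × ℝ, Complex.exp (inner ℝ (⟨p.1, p.2⟩ : ℂ) t * Complex.I) =
      Complex.exp (t.re * p.1 * Complex.I) * Complex.exp (t.im * p.2 * Complex.I) := by
    intro p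
    rw [← Complex.exp_add, Complex.inner]
    congr 1
    simp
    ring
  simp_rw [h]
  rw [integral_prod_mul (fun x : ℝ => Complex.exp (t.re * x * Complex.I))
    (fun x : ℝ => Complex.exp (t.im * x * Complex.I)), ← charFun_apply_real, ← charFun_apply_real,
    charFun_gaussianReal, charFun_gaussianReal, ← Complex.exp_add, Complex.sq_norm,
    Complex.normSq_apply]
  congr 1
  push_cast
  simp
  ring

/-- A linear combination with unit coefficient vector of independent complex normal variables is
complex normal. -/
lemma map_sum_mul_pi_complexNormal {ι : Type*} [Fintype ι] (w : ι → ℂ)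
    (hw : ∑ k, ‖w k‖ ^ 2 = 1) :
    (Measure.pi fun _ : ι => complexNormal v).map (fun h => ∑ k, h k * w k) = complexNormal v := by
  have hm : Measurable fun h : ι → ℂ => ∑ k, h k * w k := by fun_prop
  have := Measure.isProbabilityMeasure_map (μ := Measure.pi fun _ : ι => complexNormal v)
    hm.aemeasurable
  refine Measure.ext_of_charFun ?_
  ext t
  rw [charFun_apply, integral_map hm.aemeasurable
    (by fun_prop : Measurable _).aestronglyMeasurable]
  have h : ∀ x : ι → ℂ, Complex.exp (inner ℝ (∑ k, x k * w k) t * Complex.I) =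
      ∏ k, Complex.exp (inner ℝ (x k) (star (w k) * t) * Complex.I) := by
    intro x
    rw [← Complex.exp_sum, sum_inner, Complex.ofReal_sum, Finset.sum_mul]
    congr 1
    refine Finset.sum_congr rfl fun k _ => ?_
    congr 2
    simp only [Complex.inner, RCLike.star_def, map_mul]
    ring_nf
  simp_rw [h]
  rw [integral_fintype_prod_eq_prod
    (fun k (z : ℂ) => Complex.exp (inner ℝ z (star (w k) * t) * Complex.I))]
  simp_rw [← charFun_apply, charFun_complexNormal]
  rw [← Complex.exp_sum]
  congr 1
  rw [Finset.sum_neg_distrib, ← Complex.ofReal_sum]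
  congr 2
  simp_rw [norm_mul, norm_star, mul_pow]
  rw [← Finset.sum_div, ← Finset.mul_sum, ← Finset.sum_mul, hw, one_mul]

end ComplexNormal

/-! ### Independence -/

section Independence

variable {Ω : Type*} [MeasurableSpace Ω] {μ : Measure Ω}

/-- Fubini's theorem for independent random variables. -/
lemma lintegral_indepFun {α β : Type*} [MeasurableSpace α] [MeasurableSpace β]
    [IsProbabilityMeasure μ] {U : Ω → α} {V : Ω → β} (hU : Measurable U) (hV : Measurable V)
    (h : IndepFun U V μ) {F : α → β → ℝ≥0∞} (hF : Measurable (Function.uncurry F)) :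
    ∫⁻ ω, F (U ω) (V ω) ∂μ = ∫⁻ ω, ∫⁻ ω', F (U ω) (V ω') ∂μ ∂μ := by
  have := Measure.isProbabilityMeasure_map (μ := μ) hV.aemeasurable
  have h1 : ∫⁻ ω, F (U ω) (V ω) ∂μ =
      ∫⁻ p, Function.uncurry F p ∂(μ.map fun ω => (U ω, V ω)) :=
    (lintegral_map hF (hU.prodMk hV)).symm
  rw [h1, (indepFun_iff_map_prod_eq_prod_map_map hU.aemeasurable hV.aemeasurable).1 h,
    lintegral_prod _ hF.aemeasurable, lintegral_map hF.lintegral_prod_right' hU]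
  refine lintegral_congr fun ω => ?_
  rw [lintegral_map (by fun_prop) hV]
  rfl

/-- Functions of disjoint subfamilies of an independent family are independent. -/
lemma _root_.ProbabilityTheory.iIndepFun.indepFun_of_disjoint {ι α β γ : Type*}
    [MeasurableSpace α]
    [MeasurableSpace β] [MeasurableSpace γ] {f : ι → Ω → α} (hf : iIndepFun f μ)
    (hm : ∀ i, Measurable (f i)) {S T : Set ι} (hST : Disjoint S T) {U : Ω → β} {V : Ω → γ}
    (hU : Measurable[⨆ i ∈ S, MeasurableSpace.comap (f i) inferInstance] U)
    (hV : Measurable[⨆ i ∈ T, MeasurableSpace.comap (f i) inferInstance] V) :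
    IndepFun U V μ := by
  rw [IndepFun_iff_Indep]
  exact indep_of_indep_of_le_right (indep_of_indep_of_le_left
    (indep_iSup_of_disjoint (fun i => (hm i).comap_le) hf.iIndep hST) hU.comap_le) hV.comap_le

/-- The Laplace transform of an infinite sum of independent nonnegative random variables. -/
lemma lintegral_expNeg_tsum_of_indepFun [IsProbabilityMeasure μ] {Z : ℕ → Ω → ℝ≥0∞}
    (hZ : ∀ i, Measurable (Z i))
    (hind : ∀ n, IndepFun (fun ω => ∑ i ∈ Finset.range n, Z i ω) (Z n) μ) {a : ℕ → ℝ≥0∞}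
    (ha : ∀ i, ∫⁻ ω, expNeg (Z i ω) ∂μ = expNeg (a i)) :
    ∫⁻ ω, expNeg (∑' i, Z i ω) ∂μ = expNeg (∑' i, a i) := by
  have hfin : ∀ n, ∫⁻ ω, expNeg (∑ i ∈ Finset.range n, Z i ω) ∂μ =
      expNeg (∑ i ∈ Finset.range n, a i) := by
    intro n
    induction n with
    | zero => simp
    | succ n ih =>
      simp_rw [Finset.sum_range_succ, expNeg_add]
      rw [← ih, ← ha n]
      exact lintegral_mul_eq_lintegral_mul_lintegral_of_indepFun
        (f := fun ω => expNeg (∑ i ∈ Finset.range n, Z i ω)) (g := fun ω => expNeg (Z n ω))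
        (by fun_prop) (by fun_prop) ((hind n).comp measurable_expNeg measurable_expNeg)
  have h1 : Tendsto (fun n => ∫⁻ ω, expNeg (∑ i ∈ Finset.range n, Z i ω) ∂μ) atTop
      (𝓝 (∫⁻ ω, expNeg (∑' i, Z i ω) ∂μ)) := by
    refine tendsto_lintegral_of_dominated_convergence (fun _ => 1) (fun n => by fun_prop)
      (fun n => ae_of_all _ fun ω => expNeg_le_one _) (by simp) (ae_of_all _ fun ω => ?_)
    exact (continuous_expNeg.tendsto _).comp (ENNReal.tendsto_nat_tsum _)
  refine tendsto_nhds_unique h1 ?_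
  simp_rw [hfin]
  exact (continuous_expNeg.tendsto _).comp (ENNReal.tendsto_nat_tsum _)

end Independence

/-! ### Power gains -/

section Gain

/-- The power gain as a function of the channel vector to the receiver and of the channel vector
for which the precoder was chosen. -/
noncomputable def beamGain {Na : ℕ} (h h' : Fin Na → ℂ) : ℝ := ‖∑ k, h k * precoder h' k‖ ^ 2

lemma measurable_beamGain {α : Type*} [MeasurableSpace α] {Na : ℕ} {f g : α → Fin Na → ℂ}
    (hf : Measurable f) (hg : Measurable g) : Measurable fun x => beamGain (f x) (g x) := by
  unfold beamGain precoder
  have h1 : Measurable fun x => ((Real.sqrt (∑ m, ‖g x m‖ ^ 2) : ℝ) : ℂ) :=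
    Complex.measurable_ofReal.comp (by fun_prop)
  have h2 : ∀ k, Measurable fun x => star (g x k) := fun k =>
    continuous_star.measurable.comp (by fun_prop)
  fun_prop

/-- The precoder is matched to its own channel, so the product is `‖h‖² / ‖h‖ = ‖h‖`. The case `h =
0` is covered, since `0 / 0 = 0`. -/
lemma beamGain_self {Na : ℕ} (h : Fin Na → ℂ) : beamGain h h = ∑ k, ‖h k‖ ^ 2 := by
  have hS : 0 ≤ ∑ k, ‖h k‖ ^ 2 := by positivity
  have h1 : ∑ k, h k * precoder h k = ((Real.sqrt (∑ k, ‖h k‖ ^ 2) : ℝ) : ℂ) := by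
    simp_rw [precoder, ← mul_div_assoc, RCLike.star_def, Complex.mul_conj,
      Complex.normSq_eq_norm_sq]
    rw [← Finset.sum_div, ← Complex.ofReal_sum, ← Complex.ofReal_div, Real.div_sqrt]
  rw [beamGain, h1, Complex.norm_real, Real.norm_of_nonneg (Real.sqrt_nonneg _), Real.sq_sqrt hS]

lemma sum_sq_norm_precoder {Na : ℕ} {h : Fin Na → ℂ} (hh : h ≠ 0) :
    ∑ k, ‖precoder h k‖ ^ 2 = 1 := by
  have hS : 0 < ∑ k, ‖h k‖ ^ 2 := by
    obtain ⟨k, hk⟩ := Function.ne_iff.1 hh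
    exact Finset.sum_pos' (fun _ _ => by positivity)
      ⟨k, Finset.mem_univ _, by have := norm_pos_iff.2 hk; positivity⟩
  simp_rw [precoder, norm_div, norm_star, Complex.norm_real, div_pow,
    Real.norm_of_nonneg (Real.sqrt_nonneg _), Real.sq_sqrt hS.le]
  rw [← Finset.sum_div, div_self hS.ne']

variable {Ω : Type*} [MeasurableSpace Ω] {μ : Measure Ω} {Na : ℕ} {v : ℝ≥0}
  {H : ℕ → ℕ → Ω → Fin Na → ℂ}

omit [MeasurableSpace Ω] in
lemma gain_nonneg (i : ℕ) (ω : Ω) : 0 ≤ gain H i ω := by unfold gain; positivity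

omit [MeasurableSpace Ω] in
lemma gain_eq (H : ℕ → ℕ → Ω → Fin Na → ℂ) (i : ℕ) :
    gain H i = fun ω => beamGain (H 0 i ω) (H i i ω) := by
  funext ω; simp only [gain, beamGain]

lemma IsRayleighFading.measurable_gain (hH : IsRayleighFading μ Na v H) (i : ℕ) :
    Measurable (gain H i) := by
  rw [gain_eq]
  exact measurable_beamGain (hH.measurable 0 i) (hH.measurable i i)

/-- The information on the channels from the base stations with indices in `A`. -/
@[reducible] noncomputable def channels (H : ℕ → ℕ → Ω → Fin Na → ℂ) (A : Set ℕ) : MeasurableSpace Ω :=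
  ⨆ p ∈ {p : ℕ × ℕ | p.2 ∈ A}, MeasurableSpace.comap (fun ω => H p.1 p.2 ω) inferInstance

omit [MeasurableSpace Ω] in
-- The gain of station `i` involves only `H 0 i` and `H i i`, both with station index `i`. Hence
-- gains of different stations use disjoint subfamilies of the channels.
lemma measurable_gain_channels {A : Set ℕ} {i : ℕ} (hi : i ∈ A) :
    Measurable[channels H A] (gain H i) := by
  have h : ∀ j, Measurable[channels H A] (H j i) := by
    intro j
    rw [measurable_iff_comap_le]
    exact le_iSup₂_of_le (f := fun (p : ℕ × ℕ) (_ : p ∈ {p : ℕ × ℕ | p.2 ∈ A}) =>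
      MeasurableSpace.comap (fun ω => H p.1 p.2 ω) inferInstance) (j, i) hi le_rfl
  rw [gain_eq]
  exact @measurable_beamGain _ (channels H A) _ _ _ (h 0) (h i)

/-- Gains with different indices are independent. -/
lemma IsRayleighFading.indepFun_of_disjoint (hH : IsRayleighFading μ Na v H) {A B : Set ℕ}
    (hAB : Disjoint A B) {β γ : Type*} [MeasurableSpace β] [MeasurableSpace γ] {U : Ω → β}
    {V : Ω → γ}
    (hU : Measurable[channels H A] U) (hV : Measurable[channels H B] V) : IndepFun U V μ :=
  hH.indep.indepFun_of_disjoint (fun p => hH.measurable p.1 p.2)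
    (S := {p : ℕ × ℕ | p.2 ∈ A}) (T := {p : ℕ × ℕ | p.2 ∈ B})
    (Set.disjoint_left.2 fun _ hp hp' => Set.disjoint_left.1 hAB hp hp') hU hV

lemma IsRayleighFading.indepFun_gain_zero (hH : IsRayleighFading μ Na v H) :
    IndepFun (gain H 0) (fun ω i => gain H (i + 1) ω) μ := by
  refine hH.indepFun_of_disjoint (A := {0}) (B := {0}ᶜ) disjoint_compl_right
    (measurable_gain_channels rfl) ?_
  let _ : MeasurableSpace Ω := channels H {0}ᶜ
  exact measurable_pi_lambda _ fun i => measurable_gain_channels (by simp)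

/-- Since the precoder is a unit vector, the law does not depend on `h'`. -/
lemma map_beamGain_pi_complexNormal (hv : 0 < v) {h' : Fin Na → ℂ} (hh : h' ≠ 0) :
    (Measure.pi fun _ : Fin Na => complexNormal v).map (fun h => beamGain h h') =
      expLaw (2 * (v : ℝ))⁻¹ := by
  have h := congrArg (Measure.map fun z : ℂ => ‖z‖ ^ 2)
    (map_sum_mul_pi_complexNormal (v := v) (precoder h') (sum_sq_norm_precoder hh))
  rwa [Measure.map_map (by fun_prop) (by fun_prop), map_sq_norm_complexNormal hv] at h

/-- Discards the null event on which the precoder is zero instead of a unit vector. -/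
lemma IsRayleighFading.channel_ne_zero (hH : IsRayleighFading μ Na v H) (hNa : 1 ≤ Na)
    (hv : 0 < v) (j i : ℕ) : ∀ᵐ ω ∂μ, H j i ω ≠ 0 := by
  have : NeZero Na := ⟨by omega⟩
  have h0 : Measure.pi (fun _ : Fin Na => complexNormal v) {0} = 0 := by
    rw [← Set.univ_pi_singleton, Measure.pi_pi]
    exact Finset.prod_eq_zero (Finset.mem_univ 0) (complexNormal_singleton hv _)
  rw [← (hH.hasLaw j i).map_eq, Measure.map_apply (hH.measurable _ _)
    (measurableSet_singleton _)] at h0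
  exact measure_mono_null (fun ω hω => by simpa using hω) h0

/-- The gain of an interfering signal is exponential. -/
lemma IsRayleighFading.map_gain_succ [IsProbabilityMeasure μ] (hH : IsRayleighFading μ Na v H)
    (hNa : 1 ≤ Na) (hv : 0 < v) (i : ℕ) :
    μ.map (gain H (i + 1)) = expLaw (2 * (v : ℝ))⁻¹ := by
  -- The user served by station `i + 1` is not the typical user, so precoder and channel are
  -- independent and the precoder can be frozen.
  have hind : IndepFun (H (i + 1) (i + 1)) (H 0 (i + 1)) μ := by
    have h := hH.indep.indepFun (show ((i + 1, i + 1) : ℕ × ℕ) ≠ (0, i + 1) by simp)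
    exact h
  ext s hs
  have hs1 : Measurable (s.indicator (1 : ℝ → ℝ≥0∞)) := measurable_one.indicator hs
  have hF : Measurable (Function.uncurry fun (h' h : Fin Na → ℂ) =>
      s.indicator (1 : ℝ → ℝ≥0∞) (beamGain h h')) :=
    hs1.comp (measurable_beamGain measurable_snd measurable_fst)
  have hb : ∀ h' : Fin Na → ℂ, Measurable fun h => beamGain h h' := fun h' =>
    measurable_beamGain measurable_id measurable_const
  rw [← lintegral_indicator_one hs, lintegral_map hs1 (hH.measurable_gain _)]
  simp only [gain_eq]
  rw [lintegral_indepFun (F := fun h' h => s.indicator (1 : ℝ → ℝ≥0∞) (beamGain h h'))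
    (hH.measurable _ _) (hH.measurable _ _) hind hF]
  have h2 : ∀ᵐ ω ∂μ, ∫⁻ ω', s.indicator (1 : ℝ → ℝ≥0∞)
      (beamGain (H 0 (i + 1) ω') (H (i + 1) (i + 1) ω)) ∂μ = expLaw (2 * (v : ℝ))⁻¹ s := by
    filter_upwards [hH.channel_ne_zero hNa hv (i + 1) (i + 1)] with ω hω
    rw [← lintegral_map (f := fun h => s.indicator (1 : ℝ → ℝ≥0∞)
      (beamGain h (H (i + 1) (i + 1) ω))) (hs1.comp (hb _)) (hH.measurable 0 (i + 1)),
      (hH.hasLaw 0 (i + 1)).map_eq, ← lintegral_map hs1 (hb _),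
      map_beamGain_pi_complexNormal hv hω, lintegral_indicator_one hs]
  rw [lintegral_congr_ae h2]
  simp

/-- The gain of the useful signal follows the Erlang law. -/
lemma IsRayleighFading.gain_zero_gt (hH : IsRayleighFading μ Na v H) (hv : 0 < v) {y : ℝ}
    (hy : 0 ≤ y) :
    μ {ω | y < gain H 0 ω} = ENNReal.ofReal (erlangTail (2 * (v : ℝ))⁻¹ Na y) := by
  have hv' : (0 : ℝ) < v := hv
  have hms : MeasurableSet {x : Fin Na → ℝ | y < ∑ i, x i} :=
    measurableSet_lt measurable_const (by fun_prop)
  have hsq : Measurable fun (h : Fin Na → ℂ) (k : Fin Na) => ‖h k‖ ^ 2 := by fun_prop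
  have hprob := isProbabilityMeasure_expLaw (r := (2 * (v : ℝ))⁻¹) (by positivity)
  rw [← map_sq_norm_complexNormal hv] at hprob
  have hpi : (Measure.pi fun _ : Fin Na => complexNormal v).map
      (fun (h : Fin Na → ℂ) (k : Fin Na) => ‖h k‖ ^ 2) =
      Measure.pi fun _ : Fin Na => (complexNormal v).map fun z => ‖z‖ ^ 2 :=
    Measure.pi_map_pi (f := fun (_ : Fin Na) (z : ℂ) => ‖z‖ ^ 2) (fun _ => by fun_prop)
  rw [← pi_expLaw_sum_gt (by positivity) Na hy, ← map_sq_norm_complexNormal hv,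
    ← hpi, ← (hH.hasLaw 0 0).map_eq,
    Measure.map_apply hsq hms, Measure.map_apply (hH.measurable 0 0) (hsq hms)]
  congr 1
  ext ω
  have : gain H 0 ω = ∑ k, ‖H 0 0 ω k‖ ^ 2 := by rw [gain_eq]; exact beamGain_self (H 0 0 ω)
  simp [this]

lemma IsRayleighFading.lintegral_gain_succ [IsProbabilityMeasure μ]
    (hH : IsRayleighFading μ Na v H) (hNa : 1 ≤ Na) (hv : 0 < v) (i : ℕ) :
    ∫⁻ ω, ENNReal.ofReal (gain H (i + 1) ω) ∂μ =
      ∫⁻ x, ENNReal.ofReal x ∂expLaw (2 * (v : ℝ))⁻¹ := by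
  rw [← hH.map_gain_succ hNa hv i, lintegral_map (by fun_prop) (hH.measurable_gain _)]

lemma IsRayleighFading.gain_succ_pos [IsProbabilityMeasure μ]
    (hH : IsRayleighFading μ Na v H) (hNa : 1 ≤ Na) (hv : 0 < v) (i : ℕ) :
    ∀ᵐ ω ∂μ, 0 < gain H (i + 1) ω := by
  have h0 : ∀ᵐ t ∂expLaw (2 * (v : ℝ))⁻¹, 0 < t :=
    (withDensity_absolutelyContinuous _ _).ae_le (ae_restrict_mem measurableSet_Ioi)
  rw [← hH.map_gain_succ hNa hv i] at h0
  exact ae_of_ae_map (hH.measurable_gain _).aemeasurable h0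

/-- The Laplace transform of a weighted sum of the gains of the interfering signals. -/
lemma IsRayleighFading.lintegral_expNeg_tsum [IsProbabilityMeasure μ]
    (hH : IsRayleighFading μ Na v H) (hNa : 1 ≤ Na) (hv : 0 < v) {a : ℕ → ℝ} (ha : ∀ i, 0 ≤ a i) :
    ∫⁻ ω, expNeg (∑' i, ENNReal.ofReal (a i * gain H (i + 1) ω)) ∂μ =
      expNeg (∑' i, ENNReal.ofReal (Real.log (1 + 2 * v * a i))) := by
  have hv' : (0 : ℝ) < v := hv
  refine lintegral_expNeg_tsum_of_indepFun (fun i => ?_) (fun n => ?_) (fun i => ?_)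
  · exact ((hH.measurable_gain _).const_mul _).ennreal_ofReal
  -- The first `n` interferers have station indices `1, …, n`, the next one `n + 1`.
  · refine hH.indepFun_of_disjoint (A := {i | i ≤ n}) (B := {n + 1})
      (by simp) ?_ ?_
    · let _ : MeasurableSpace Ω := channels H {i | i ≤ n}
      refine Finset.measurable_fun_sum _ fun i hi => ?_
      have := measurable_gain_channels (H := H) (A := {i | i ≤ n}) (i := i + 1)
        (Finset.mem_range.1 hi)
      exact (this.const_mul _).ennreal_ofReal
    · let _ : MeasurableSpace Ω := channels H {n + 1}
      have := measurable_gain_channels (H := H) (A := {n + 1}) (i := n + 1) rfl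
      exact (this.const_mul _).ennreal_ofReal
  · have h := ha i
    have h0 : 0 ≤ 2 * v * a i := by positivity
    rw [← lintegral_map (f := fun x => expNeg (ENNReal.ofReal (a i * x))) (by fun_prop)
      (hH.measurable_gain _), hH.map_gain_succ hNa hv, lintegral_expNeg_expLaw (by positivity) h,
      expNeg_ofReal (Real.log_nonneg (by linarith)), Real.exp_neg, Real.exp_log (by linarith)]
    congr 1
    field_simp

end Gain

/-! ### Derivatives of Laplace transforms -/

section LaplaceDeriv

variable (κ : Measure ℝ≥0) [IsProbabilityMeasure κ]

/-- On `[0, ∞)` the function `exp (u * y)` is bounded for `u < 0`; no moment condition on `κ` is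
needed. -/
lemma mem_interior_integrableExpSet {t : ℝ} (ht : t < 0) :
    t ∈ interior (integrableExpSet (fun y : ℝ≥0 => (y : ℝ)) κ) := by
  refine mem_interior.2 ⟨Iio 0, fun u hu => ?_, isOpen_Iio, ht⟩
  refine Integrable.of_bound (by fun_prop) 1 (ae_of_all _ fun y => ?_)
  rw [Real.norm_of_nonneg (Real.exp_pos _).le, Real.exp_le_one_iff]
  exact mul_nonpos_of_nonpos_of_nonneg (le_of_lt hu) y.2

/-- If `L` is a continuous function that agrees with the Laplace transform of `κ` at the positive
rational numbers, the derivatives of `L` are the moments of the exponentially tilted law. -/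
lemma iteratedDeriv_laplace {L : ℝ → ℝ} (hL : ContinuousOn L (Ioi 0))
    (h : ∀ q : ℚ, (0 : ℝ) < q → ∫ y : ℝ≥0, Real.exp (-q * y) ∂κ = L q) {s : ℝ} (hs : 0 < s)
    (k : ℕ) :
    iteratedDeriv k L s = (-1) ^ k * ∫ y : ℝ≥0, (y : ℝ) ^ k * Real.exp (-s * y) ∂κ := by
  set m : ℝ → ℝ := fun s => mgf (fun y : ℝ≥0 => (y : ℝ)) κ (-s) with hm
  have hmc : ContinuousOn m (Ioi 0) := by
    refine (continuousOn_mgf (X := fun y : ℝ≥0 => (y : ℝ)) (μ := κ)).comp continuousOn_neg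
      fun x hx => mem_interior_integrableExpSet κ (neg_lt_zero.2 hx)
  -- Two continuous functions that agree on a dense set. Rational points suffice, which later keeps
  -- the exceptional null sets countable in number.
  have heq : ∀ x, 0 < x → L x = m x := by
    intro x hx
    by_contra hne
    have hd : ContinuousAt (fun y => L y - m y) x :=
      (hL.continuousAt (Ioi_mem_nhds hx)).sub (hmc.continuousAt (Ioi_mem_nhds hx))
    have hev := (hd.eventually_ne (sub_ne_zero.2 hne)).and (Ioi_mem_nhds hx)
    obtain ⟨U, hU, hUo, hxU⟩ := mem_nhds_iff.1 hev
    obtain ⟨q, hq⟩ := Rat.denseRange_cast.exists_mem_open hUo ⟨x, hxU⟩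
    obtain ⟨h1, h2⟩ := hU hq
    refine h1 (sub_eq_zero.2 ?_)
    rw [← h q h2]
    rfl
  have hev : L =ᶠ[𝓝 s] m := by
    filter_upwards [Ioi_mem_nhds hs] with x hx using heq x hx
  rw [hev.iteratedDeriv_eq, hm, iteratedDeriv_comp_neg,
    iteratedDeriv_mgf (mem_interior_integrableExpSet κ (neg_lt_zero.2 hs)), smul_eq_mul]

/-- The signs of `(-s) ^ k` and of the `k`-th derivative cancel, so the terms are `s ^ k / k!` times
tilted moments, which sum to the Erlang tail under the integral. -/
lemma sum_iteratedDeriv_laplace {L : ℝ → ℝ} (hL : ContinuousOn L (Ioi 0))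
    (h : ∀ q : ℚ, (0 : ℝ) < q → ∫ y : ℝ≥0, Real.exp (-q * y) ∂κ = L q) {s : ℝ} (hs : 0 < s)
    (n : ℕ) :
    ∑ k ∈ Finset.range n, (-s) ^ k / (k.factorial : ℝ) * iteratedDeriv k L s =
      ∫ y : ℝ≥0, erlangTail 1 n (s * y) ∂κ := by
  have hint : ∀ k, Integrable (fun y : ℝ≥0 => (y : ℝ) ^ k * Real.exp (-s * y)) κ := fun k =>
    integrable_pow_mul_exp_of_mem_interior_integrableExpSet
      (mem_interior_integrableExpSet κ (neg_lt_zero.2 hs)) k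
  have h1 : ∀ y : ℝ≥0, erlangTail 1 n (s * y) =
      ∑ k ∈ Finset.range n, s ^ k / (k.factorial : ℝ) * ((y : ℝ) ^ k * Real.exp (-s * y)) := by
    intro y
    rw [erlangTail, Finset.mul_sum]
    refine Finset.sum_congr rfl fun k _ => ?_
    rw [one_mul, mul_pow, neg_mul]; ring
  simp_rw [h1]
  rw [integral_finsetSum _ fun k _ => (hint k).const_mul _]
  refine Finset.sum_congr rfl fun k _ => ?_
  rw [integral_const_mul, iteratedDeriv_laplace κ hL h hs, ← mul_assoc, neg_pow]
  congr 1
  have h2 : ((-1 : ℝ) ^ k) * (-1) ^ k = 1 := by rw [← mul_pow]; simp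
  linear_combination (s ^ k / (k.factorial : ℝ)) * h2

end LaplaceDeriv

/-! ### The interference -/

section Interference

variable {N Na : ℕ} (M : MultiSlope N) {P c : ℝ}

/-- The extended nonnegative interference power as a function of the positions of the base stations
and of the gains of the interfering signals. -/
noncomputable def eInterference (P c : ℝ) (x : ℕ → Plane) (g : ℕ → ℝ) : ℝ≥0∞ :=
  ∑' i, ENNReal.ofReal (P * g i * M.pathloss (slant c (x (i + 1))))

lemma measurable_eInterference {α : Type*} [MeasurableSpace α] {f : α → ℕ → Plane} {g : α → ℕ → ℝ}
    (hf : Measurable f) (hg : Measurable g) :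
    Measurable fun a => eInterference M P c (f a) (g a) := by
  unfold eInterference
  refine Measurable.tsum fun i => Measurable.ennreal_ofReal ?_
  have hfi : Measurable fun a => f a (i + 1) := by fun_prop
  have h2 : Measurable fun a => M.pathloss (slant c (f a (i + 1))) :=
    M.measurable_pathloss.comp ((measurable_slant c).comp hfi)
  fun_prop

variable {Ω : Type*} [MeasurableSpace Ω] {μ : Measure Ω} [IsProbabilityMeasure μ]
  {lam v : ℝ≥0} {X : ℕ → Ω → Plane} {H : ℕ → ℕ → Ω → Fin Na → ℂ}

omit [MeasurableSpace Ω] in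
lemma slant_pos (hc : 0 < c) (x : Plane) : 0 < slant c x := hc.trans_le (le_slant c x)

omit [MeasurableSpace Ω] in
lemma power_nonneg (hP : 0 < P) (hc : 0 < c) (i : ℕ) (ω : Ω) : 0 ≤ power M P c X H i ω :=
  mul_nonneg (mul_nonneg hP.le (gain_nonneg i ω)) (M.pathloss_nonneg (slant_pos hc (X i ω)))

omit [MeasurableSpace Ω] in
lemma eInterference_eq (ω : Ω) :
    eInterference M P c (fun i => X i ω) (fun i => gain H (i + 1) ω) =
      ∑' i, ENNReal.ofReal (power M P c X H (i + 1) ω) := rfl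

omit [MeasurableSpace Ω] in
-- Valid even for a divergent sum: the real `tsum` is then 0 by default, and so is `toReal` of `∞`.
lemma interference_eq (hP : 0 < P) (hc : 0 < c) (ω : Ω) :
    interference M P c X H ω =
      (eInterference M P c (fun i => X i ω) (fun i => gain H (i + 1) ω)).toReal := by
  rw [eInterference_eq, ENNReal.tsum_toReal_eq fun _ => ENNReal.ofReal_ne_top]
  exact tsum_congr fun i => (ENNReal.toReal_ofReal (power_nonneg M hP hc _ ω)).symm

omit [IsProbabilityMeasure μ] in
lemma indepFun_positions_gains (hXH : IndepFun (fun ω i => X i ω) (fun ω j i => H j i ω) μ) :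
    IndepFun (fun ω i => X i ω) (fun ω => (gain H 0 ω, fun i => gain H (i + 1) ω)) μ := by
  have hm : ∀ i, Measurable fun h : ℕ → ℕ → Fin Na → ℂ => beamGain (h 0 i) (h i i) := fun i =>
    measurable_beamGain (by fun_prop) (by fun_prop)
  have hm' : Measurable fun h : ℕ → ℕ → Fin Na → ℂ =>
      (beamGain (h 0 0) (h 0 0), fun i : ℕ => beamGain (h 0 (i + 1)) (h (i + 1) (i + 1))) :=
    (hm 0).prodMk (measurable_pi_lambda _ fun i => hm (i + 1))
  have h := hXH.comp measurable_id hm'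
  simp only [gain_eq]
  exact h

/-- The height difference keeps all distances above `c > 0`, away from the possible singularity of
the pathloss at 0. -/
lemma lintegral_pathloss_ne_top (hc : 0 < c) :
    ∫⁻ x : Plane, ENNReal.ofReal (M.pathloss (slant c x)) ≠ ∞ := by
  rw [lintegral_slant (f := fun x => ENNReal.ofReal (M.pathloss x)) hc.le
    M.measurable_pathloss.ennreal_ofReal, ← restrict_Ioi_eq_restrict_Ici]
  have h := ((M.integrableOn_mul_pathloss hc).const_mul (2 * Real.pi)).lintegral_lt_top.ne
  convert h using 1
  refine setLIntegral_congr_fun measurableSet_Ioi fun x hx => ?_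
  have : 0 < x := hc.trans hx
  rw [← ENNReal.ofReal_mul (by positivity), mul_assoc]

/-- The interference is almost surely finite. -/
lemma eInterference_ne_top (hX : IsPoissonProcess μ lam X) (hH : IsRayleighFading μ Na v H)
    (hXH : IndepFun (fun ω i => X i ω) (fun ω j i => H j i ω) μ) (hNa : 1 ≤ Na) (hv : 0 < v)
    (hP : 0 < P) (hc : 0 < c) :
    ∀ᵐ ω ∂μ, eInterference M P c (fun i => X i ω) (fun i => gain H (i + 1) ω) ≠ ∞ := by
  have hXm : Measurable fun ω i => X i ω := measurable_pi_lambda _ hX.measurable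
  have hGm : Measurable fun ω i => gain H (i + 1) ω :=
    measurable_pi_lambda _ fun i => hH.measurable_gain _
  have hl : ∀ i, Measurable fun ω => ENNReal.ofReal (M.pathloss (slant c (X i ω))) := fun i =>
    (M.measurable_pathloss.comp ((measurable_slant c).comp (hX.measurable i))).ennreal_ofReal
  set C := ∫⁻ x, ENNReal.ofReal x ∂expLaw (2 * (v : ℝ))⁻¹ with hC
  have hCt : C ≠ ∞ := lintegral_ofReal_expLaw_ne_top (by
    have : (0 : ℝ) < v := hv
    positivity)
  have hind : ∀ i, IndepFun (fun ω => ENNReal.ofReal (gain H (i + 1) ω))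
      (fun ω => ENNReal.ofReal (M.pathloss (slant c (X (i + 1) ω)))) μ := by
    intro i
    have hm : Measurable fun p : ℝ × (ℕ → ℝ) => ENNReal.ofReal (p.2 i) := by fun_prop
    have hm' : Measurable fun x : ℕ → Plane =>
        ENNReal.ofReal (M.pathloss (slant c (x (i + 1)))) :=
      (M.measurable_pathloss.comp ((measurable_slant c).comp
        (measurable_pi_apply (i + 1)))).ennreal_ofReal
    exact ((indepFun_positions_gains hXH).comp hm' hm).symm
  have hterm : ∀ i, ∫⁻ ω, ENNReal.ofReal (P * gain H (i + 1) ω *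
      M.pathloss (slant c (X (i + 1) ω))) ∂μ =
      ENNReal.ofReal P * C * ∫⁻ ω, ENNReal.ofReal (M.pathloss (slant c (X (i + 1) ω))) ∂μ := by
    intro i
    have h1 : ∀ ω, ENNReal.ofReal (P * gain H (i + 1) ω * M.pathloss (slant c (X (i + 1) ω))) =
        ENNReal.ofReal P * (ENNReal.ofReal (gain H (i + 1) ω) *
          ENNReal.ofReal (M.pathloss (slant c (X (i + 1) ω)))) := by
      intro ω
      rw [mul_assoc, ENNReal.ofReal_mul hP.le, ENNReal.ofReal_mul (gain_nonneg _ _)]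
    simp_rw [h1]
    rw [lintegral_const_mul (f := fun ω => ENNReal.ofReal (gain H (i + 1) ω) *
        ENNReal.ofReal (M.pathloss (slant c (X (i + 1) ω)))) _
        ((hH.measurable_gain _).ennreal_ofReal.mul (hl _)),
      lintegral_mul_eq_lintegral_mul_lintegral_of_indepFun''
        (f := fun ω => ENNReal.ofReal (gain H (i + 1) ω))
        (g := fun ω => ENNReal.ofReal (M.pathloss (slant c (X (i + 1) ω))))
        (hH.measurable_gain _).ennreal_ofReal.aemeasurable
        (hl _).aemeasurable (hind i), hH.lintegral_gain_succ hNa hv, mul_assoc]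
  -- Even the mean is finite: up to the mean gain, it is at most the Campbell integral over all
  -- stations, station 0 included.
  have hfin : ∫⁻ ω, eInterference M P c (fun i => X i ω) (fun i => gain H (i + 1) ω) ∂μ ≠ ∞ := by
    simp only [eInterference]
    rw [lintegral_tsum (f := fun i ω => ENNReal.ofReal (P * gain H (i + 1) ω *
      M.pathloss (slant c (X (i + 1) ω)))) fun i => Measurable.aemeasurable <| Measurable.ennreal_ofReal <|
      ((hH.measurable_gain _).const_mul P).mul
        (M.measurable_pathloss.comp ((measurable_slant c).comp (hX.measurable (i + 1))))]
    simp_rw [hterm]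
    rw [ENNReal.tsum_mul_left]
    refine ENNReal.mul_ne_top (ENNReal.mul_ne_top ENNReal.ofReal_ne_top hCt) ?_
    have h2 := hX.lintegral_tsum (φ := fun x => ENNReal.ofReal (M.pathloss (slant c x)))
      (M.measurable_pathloss.comp (measurable_slant c)).ennreal_ofReal
    rw [lintegral_tsum fun i => (hl i).aemeasurable] at h2
    refine ne_top_of_le_ne_top (ENNReal.mul_ne_top (ENNReal.coe_ne_top (r := lam))
      (lintegral_pathloss_ne_top M hc)) ?_
    rw [← h2]
    exact ENNReal.tsum_comp_le_tsum_of_injective (add_left_injective 1) _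
  filter_upwards [ae_lt_top (measurable_eInterference M hXm hGm) hfin] with ω hω using hω.ne

/-- Zero interference must be null: there `sir` is 0 by the convention for division, whereas the
Erlang tail at 0 is 1. -/
lemma eInterference_ne_zero (hH : IsRayleighFading μ Na v H) (hNa : 1 ≤ Na) (hv : 0 < v)
    (hP : 0 < P) (hc : 0 < c) :
    ∀ᵐ ω ∂μ, eInterference M P c (fun i => X i ω) (fun i => gain H (i + 1) ω) ≠ 0 := by
  filter_upwards [hH.gain_succ_pos hNa hv 0] with ω hω h
  have h0 := ENNReal.tsum_eq_zero.1 h 0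
  rw [ENNReal.ofReal_eq_zero] at h0
  exact absurd h0 (not_le.2 (mul_pos (mul_pos hP hω) (M.pathloss_pos (slant_pos hc _))))

/-- The conditional Laplace transform of the interference given the serving distance. -/
lemma setLIntegral_expNeg_eInterference (hX : IsPoissonProcess μ lam X) (hlam : 0 < lam)
    (hnear : ∀ᵐ ω ∂μ, ∀ i, ‖X 0 ω‖ ≤ ‖X i ω‖) (hH : IsRayleighFading μ Na v H)
    (hXH : IndepFun (fun ω i => X i ω) (fun ω j i => H j i ω) μ) (hNa : 1 ≤ Na) (hv : 0 < v)
    (hP : 0 < P) (hc : 0 < c) {s : ℝ} (hs : 0 ≤ s) {B : Set ℝ} (hB : MeasurableSet B) :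
    ∫⁻ ω in dist3 c X 0 ⁻¹' B, expNeg (ENNReal.ofReal (s / v) *
      eInterference M P c (fun i => X i ω) (fun i => gain H (i + 1) ω)) ∂μ =
    ∫⁻ ω in dist3 c X 0 ⁻¹' B, ENNReal.ofReal (laplaceForm M lam P (dist3 c X 0 ω) s) ∂μ := by
  have hv' : (0 : ℝ) < v := hv
  have hXm : Measurable fun ω i => X i ω := measurable_pi_lambda _ hX.measurable
  have hGm : Measurable fun ω i => gain H (i + 1) ω :=
    measurable_pi_lambda _ fun i => hH.measurable_gain _
  have hD := hX.measurable_dist3 (c := c) 0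
  rw [← hX.setLIntegral_expNeg_tsum_succ M hlam hnear hP hc hs hB,
    ← lintegral_indicator (hD hB), ← lintegral_indicator (hD hB)]
  -- The event on the serving distance depends on positions only, so Fubini allows the gains to be
  -- integrated first with all positions fixed.
  set F : (ℕ → Plane) → (ℕ → ℝ) → ℝ≥0∞ := fun x g =>
    ((fun x : ℕ → Plane => slant c (x 0)) ⁻¹' B).indicator 1 x *
      expNeg (ENNReal.ofReal (s / v) * eInterference M P c x g) with hF
  have hFm : Measurable (Function.uncurry F) := by
    have h1 : Measurable fun x : ℕ → Plane => slant c (x 0) :=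
      (measurable_slant c).comp (measurable_pi_apply 0)
    have h2 : Measurable (((fun x : ℕ → Plane => slant c (x 0)) ⁻¹' B).indicator
      (1 : (ℕ → Plane) → ℝ≥0∞)) := measurable_one.indicator (h1 hB)
    exact (h2.comp measurable_fst).mul (measurable_expNeg.comp
      ((measurable_eInterference M measurable_fst measurable_snd).const_mul _))
  have hind : IndepFun (fun ω i => X i ω) (fun ω i => gain H (i + 1) ω) μ :=
    (indepFun_positions_gains hXH).comp measurable_id measurable_snd
  have h1 := lintegral_indepFun hXm hGm hind hFm
  have hl : ∀ ω, (dist3 c X 0 ⁻¹' B).indicator (fun ω => expNeg (ENNReal.ofReal (s / v) *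
      eInterference M P c (fun i => X i ω) (fun i => gain H (i + 1) ω))) ω =
      F (fun i => X i ω) (fun i => gain H (i + 1) ω) := by
    intro ω
    by_cases h : slant c (X 0 ω) ∈ B
    · rw [indicator_of_mem (show ω ∈ dist3 c X 0 ⁻¹' B from h), hF]
      simp [indicator_of_mem, h]
    · rw [indicator_of_notMem (show ω ∉ dist3 c X 0 ⁻¹' B from h), hF]
      simp [h]
  simp_rw [hl]
  rw [h1]
  refine lintegral_congr fun ω => ?_
  have ha : ∀ i, 0 ≤ s / v * P * M.pathloss (slant c (X (i + 1) ω)) := fun i =>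
    mul_nonneg (by positivity) (M.pathloss_nonneg (slant_pos hc _))
  have h2 := hH.lintegral_expNeg_tsum hNa hv ha
  have h3 : ∀ ω', F (fun i => X i ω) (fun i => gain H (i + 1) ω') =
      ((fun x : ℕ → Plane => slant c (x 0)) ⁻¹' B).indicator 1 (fun i => X i ω) *
      expNeg (∑' i, ENNReal.ofReal (s / v * P * M.pathloss (slant c (X (i + 1) ω)) *
        gain H (i + 1) ω')) := by
    intro ω'
    simp only [hF, eInterference, ← ENNReal.tsum_mul_left]
    congr 3
    ext i
    rw [← ENNReal.ofReal_mul (by positivity)]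
    congr 1; ring
  simp_rw [h3]
  rw [lintegral_const_mul (f := fun ω' => expNeg (∑' i, ENNReal.ofReal
    (s / v * P * M.pathloss (slant c (X (i + 1) ω)) * gain H (i + 1) ω'))) _ (measurable_expNeg.comp (Measurable.tsum fun i =>
    ((hH.measurable_gain _).const_mul _).ennreal_ofReal)), h2]
  -- Here the variance cancels, which is why the closed form is the transform of `I / v`.
  have h4 : ∀ i, 1 + 2 * v * (s / v * P * M.pathloss (slant c (X (i + 1) ω))) =
      1 + 2 * s * P * M.pathloss (slant c (X (i + 1) ω)) := fun i => by field_simp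
  simp_rw [h4]
  by_cases h : slant c (X 0 ω) ∈ B
  · rw [indicator_of_mem (show ω ∈ dist3 c X 0 ⁻¹' B from h)]
    simp only [indicator, mem_preimage, h, if_true, Pi.one_apply, one_mul]
    rfl
  · rw [indicator_of_notMem (show ω ∉ dist3 c X 0 ⁻¹' B from h)]
    simp [h]

/-- The probability of coverage in terms of the interference and the serving distance. -/
lemma measure_coverage (hX : IsPoissonProcess μ lam X) (hH : IsRayleighFading μ Na v H)
    (hXH : IndepFun (fun ω i => X i ω) (fun ω j i => H j i ω) μ) (hNa : 1 ≤ Na) (hv : 0 < v)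
    (hP : 0 < P) (hc : 0 < c) {τ : ℝ} (hτ : 0 < τ) :
    μ {ω | τ < sir M P c X H ω} = ∫⁻ ω, ENNReal.ofReal (erlangTail 1 Na
      (τ / (2 * P * M.pathloss (dist3 c X 0 ω)) * (interference M P c X H ω / v))) ∂μ := by
  classical
  have hv' : (0 : ℝ) < v := hv
  have hXm : Measurable fun ω i => X i ω := measurable_pi_lambda _ hX.measurable
  have hG0 := hH.measurable_gain 0
  have hGm : Measurable fun ω i => gain H (i + 1) ω :=
    measurable_pi_lambda _ fun i => hH.measurable_gain _
  have hl0 : Measurable fun x : ℕ → Plane => M.pathloss (slant c (x 0)) :=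
    M.measurable_pathloss.comp ((measurable_slant c).comp (measurable_pi_apply 0))
  set S : Set ((ℕ → Plane) × ℝ × (ℕ → ℝ)) := {p | τ < P * p.2.1 * M.pathloss (slant c (p.1 0)) /
    (eInterference M P c p.1 p.2.2).toReal} with hS
  have hSm : MeasurableSet S := by
    have h1 : Measurable fun p : (ℕ → Plane) × ℝ × (ℕ → ℝ) => M.pathloss (slant c (p.1 0)) :=
      hl0.comp measurable_fst
    have h2 : Measurable fun p : (ℕ → Plane) × ℝ × (ℕ → ℝ) =>
        (eInterference M P c p.1 p.2.2).toReal :=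
      (measurable_eInterference M measurable_fst
        (measurable_snd.comp measurable_snd)).ennreal_toReal
    refine measurableSet_lt measurable_const (Measurable.div (Measurable.mul ?_ h1) h2)
    fun_prop
  -- Coverage probability with positions and interfering gains fixed; the first case reflects `x / 0
  -- = 0` in the ratio.
  set T : (ℕ → Plane) → (ℕ → ℝ) → ℝ≥0∞ := fun x g =>
    if (eInterference M P c x g).toReal = 0 then 0 else
      ENNReal.ofReal (erlangTail (2 * (v : ℝ))⁻¹ Na
        (τ * (eInterference M P c x g).toReal / (P * M.pathloss (slant c (x 0))))) with hT
  have hTm : Measurable (Function.uncurry T) := by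
    have h1 : Measurable fun p : (ℕ → Plane) × (ℕ → ℝ) => M.pathloss (slant c (p.1 0)) :=
      hl0.comp measurable_fst
    have h2 : Measurable fun p : (ℕ → Plane) × (ℕ → ℝ) => (eInterference M P c p.1 p.2).toReal :=
      (measurable_eInterference M measurable_fst measurable_snd).ennreal_toReal
    have h3 : Measurable fun y => erlangTail (2 * (v : ℝ))⁻¹ Na y := by
      unfold erlangTail; fun_prop
    refine Measurable.ite (h2 (measurableSet_singleton 0)) measurable_const
      (h3.comp ((h2.const_mul τ).div (h1.const_mul P))).ennreal_ofReal
  have hind := indepFun_positions_gains hXH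
  have hind' : IndepFun (fun ω i => X i ω) (fun ω i => gain H (i + 1) ω) μ :=
    hind.comp measurable_id measurable_snd
  have hSi : Measurable (S.indicator (1 : (ℕ → Plane) × ℝ × (ℕ → ℝ) → ℝ≥0∞)) := measurable_one.indicator hSm
  have hcover : μ {ω | τ < sir M P c X H ω} =
      ∫⁻ ω, S.indicator (1 : (ℕ → Plane) × ℝ × (ℕ → ℝ) → ℝ≥0∞)
        (fun i => X i ω, gain H 0 ω, fun i => gain H (i + 1) ω) ∂μ := by
    have hm : Measurable fun ω => ((fun i => X i ω, gain H 0 ω, fun i => gain H (i + 1) ω) :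
      (ℕ → Plane) × ℝ × (ℕ → ℝ)) := hXm.prodMk (hG0.prodMk hGm)
    have hset : {ω | τ < sir M P c X H ω} = (fun ω =>
        ((fun i => X i ω, gain H 0 ω, fun i => gain H (i + 1) ω) :
          (ℕ → Plane) × ℝ × (ℕ → ℝ))) ⁻¹' S := by
      ext ω
      simp only [Set.mem_ofPred_eq, mem_preimage, hS, sir, interference_eq M hP hc]
      rfl
    rw [hset, ← lintegral_indicator_one (hm hSm)]
    rfl
  have hinner : ∀ (x : ℕ → Plane) (g : ℕ → ℝ),
      ∫⁻ ω, S.indicator (1 : (ℕ → Plane) × ℝ × (ℕ → ℝ) → ℝ≥0∞) (x, gain H 0 ω, g) ∂μ = T x g := by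
    intro x g
    have hm : Measurable fun ω => ((x, gain H 0 ω, g) : (ℕ → Plane) × ℝ × (ℕ → ℝ)) := by fun_prop
    have h1 : ∫⁻ ω, S.indicator (1 : (ℕ → Plane) × ℝ × (ℕ → ℝ) → ℝ≥0∞) (x, gain H 0 ω, g) ∂μ =
        μ ((fun ω => ((x, gain H 0 ω, g) : (ℕ → Plane) × ℝ × (ℕ → ℝ))) ⁻¹' S) := by
      rw [← lintegral_indicator_one (hm hSm)]; rfl
    rw [h1]
    have hl := M.pathloss_pos (slant_pos hc (x 0))
    by_cases h : (eInterference M P c x g).toReal = 0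
    · simp only [hT, h, if_true]
      convert measure_empty (μ := μ)
      ext ω
      simp [hS, h, hτ.le]
    · have hpos : 0 < (eInterference M P c x g).toReal :=
        lt_of_le_of_ne ENNReal.toReal_nonneg (Ne.symm h)
      simp only [hT, h, if_false]
      rw [← hH.gain_zero_gt hv (by positivity)]
      congr 1
      ext ω
      simp only [hS, mem_preimage, Set.mem_ofPred_eq]
      rw [lt_div_iff₀ hpos, div_lt_iff₀ (by positivity)]
      constructor <;> intro h' <;> linarith
  rw [hcover, lintegral_indepFun (F := fun x p => S.indicator (1 : (ℕ → Plane) × ℝ × (ℕ → ℝ) → ℝ≥0∞) (x, p)) hXm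
    (hG0.prodMk hGm) hind hSi]
  have h2 : ∀ ω, ∫⁻ ω', S.indicator (1 : (ℕ → Plane) × ℝ × (ℕ → ℝ) → ℝ≥0∞)
      (fun i => X i ω, gain H 0 ω', fun i => gain H (i + 1) ω') ∂μ =
      ∫⁻ ω', T (fun i => X i ω) (fun i => gain H (i + 1) ω') ∂μ := by
    intro ω
    rw [lintegral_indepFun (F := fun g g0 => S.indicator (1 : (ℕ → Plane) × ℝ × (ℕ → ℝ) → ℝ≥0∞)
      (fun i => X i ω, g0, g)) hGm hG0 hH.indepFun_gain_zero.symm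
      (hSi.comp (by fun_prop : Measurable fun p : (ℕ → ℝ) × ℝ =>
        (((fun i => X i ω), p.2, p.1) : (ℕ → Plane) × ℝ × (ℕ → ℝ))))]
    simp_rw [hinner]
  simp_rw [h2]
  rw [← lintegral_indepFun hXm hGm hind' hTm]
  refine lintegral_congr_ae ?_
  filter_upwards [eInterference_ne_top M hX hH hXH hNa hv hP hc,
    eInterference_ne_zero M (X := X) hH hNa hv hP hc] with ω h3 h4
  have h5 : (eInterference M P c (fun i => X i ω) fun i => gain H (i + 1) ω).toReal ≠ 0 :=
    ENNReal.toReal_ne_zero.2 ⟨h4, h3⟩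
  have hl := M.pathloss_pos (slant_pos hc (X 0 ω))
  simp only [hT, h5, if_false, interference_eq M hP hc, erlangTail]
  change _ = ENNReal.ofReal (Real.exp (-(1 * (τ / (2 * P * M.pathloss (slant c (X 0 ω))) * _))) * _)
  set I := (eInterference M P c (fun i => X i ω) fun i => gain H (i + 1) ω).toReal
  -- Gain rate `1 / (2v)` times the threshold `τ I / (P l)` is `s * (I / v)` with `s = τ / (2 P l)`,
  -- the evaluation point of the theorem.
  have h6 : (2 * (v : ℝ))⁻¹ * (τ * I / (P * M.pathloss (slant c (X 0 ω)))) =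
      1 * (τ / (2 * P * M.pathloss (slant c (X 0 ω))) * (I / v)) := by field_simp
  rw [h6]
  rfl

end Interference

/-! ### Conditional Laplace transform and conditional coverage probability given the serving
distance. -/

section Coverage

variable {N Na : ℕ} (M : MultiSlope N) {P c : ℝ}
  {Ω : Type*} [MeasurableSpace Ω] {μ : Measure Ω} [IsProbabilityMeasure μ]
  {lam v : ℝ≥0} {X : ℕ → Ω → Plane} {H : ℕ → ℕ → Ω → Fin Na → ℂ}

omit [MeasurableSpace Ω] in
lemma dist3_pos (hc : 0 < c) (i : ℕ) (ω : Ω) : 0 < dist3 c X i ω := hc.trans_le (le_dist3 i ω)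

omit [MeasurableSpace Ω] in
lemma interference_nonneg (hP : 0 < P) (hc : 0 < c) (ω : Ω) : 0 ≤ interference M P c X H ω := by
  rw [interference_eq M hP hc]; exact ENNReal.toReal_nonneg

omit [IsProbabilityMeasure μ] in
lemma measurable_interference (hX : IsPoissonProcess μ lam X) (hH : IsRayleighFading μ Na v H)
    (hP : 0 < P) (hc : 0 < c) : Measurable (interference M P c X H) := by
  have h := (measurable_eInterference M (P := P) (c := c) (measurable_pi_lambda _ hX.measurable)
    (measurable_pi_lambda _ fun i => hH.measurable_gain (i + 1))).ennreal_toReal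
  rwa [← funext (interference_eq M hP hc)] at h

lemma integrable_exp_interference (hX : IsPoissonProcess μ lam X) (hH : IsRayleighFading μ Na v H)
    (hP : 0 < P) (hc : 0 < c) {s : ℝ} (hs : 0 ≤ s) :
    Integrable (fun ω => Real.exp (-s * (interference M P c X H ω / v))) μ := by
  have hm := measurable_interference M hX hH hP hc
  refine Integrable.of_bound (by fun_prop) 1 (ae_of_all _ fun ω => ?_)
  rw [Real.norm_of_nonneg (Real.exp_pos _).le, Real.exp_le_one_iff, neg_mul, neg_nonpos]
  exact mul_nonneg hs (div_nonneg (interference_nonneg M hP hc ω) v.2)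

lemma integrable_laplaceForm_dist3 (hX : IsPoissonProcess μ lam X) (hP : 0 < P) (hc : 0 < c)
    {s : ℝ} (hs : 0 ≤ s) : Integrable (fun ω => laplaceForm M lam P (dist3 c X 0 ω) s) μ := by
  refine Integrable.of_bound
    ((measurable_laplaceForm M s).comp (hX.measurable_dist3 0)).aestronglyMeasurable 1
    (ae_of_all _ fun ω => ?_)
  rw [Real.norm_of_nonneg (laplaceForm_pos M s).le]
  exact laplaceForm_le_one M hP hs (dist3_pos hc 0 ω)

/-- The closed form is the conditional Laplace transform of the interference. -/
lemma condExp_exp_interference (hX : IsPoissonProcess μ lam X) (hlam : 0 < lam)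
    (hnear : ∀ᵐ ω ∂μ, ∀ i, ‖X 0 ω‖ ≤ ‖X i ω‖) (hH : IsRayleighFading μ Na v H)
    (hXH : IndepFun (fun ω i => X i ω) (fun ω j i => H j i ω) μ) (hNa : 1 ≤ Na) (hv : 0 < v)
    (hP : 0 < P) (hc : 0 < c) {s : ℝ} (hs : 0 ≤ s) :
    μ[fun ω => Real.exp (-s * (interference M P c X H ω / v)) |
        MeasurableSpace.comap (dist3 c X 0) inferInstance]
      =ᵐ[μ] fun ω => laplaceForm M lam P (dist3 c X 0 ω) s := by
  have hD := hX.measurable_dist3 (c := c) 0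
  have hI := integrable_exp_interference M hX hH hP hc hs
  have hL := integrable_laplaceForm_dist3 M hX hP hc hs
  refine (ae_eq_condExp_of_forall_setIntegral_eq hD.comap_le hI (fun _ _ _ => hL.integrableOn) ?_
    ?_).symm
  · rintro _ ⟨B, hB, rfl⟩ -
    rw [integral_eq_lintegral_of_nonneg_ae (ae_of_all _ fun ω => (laplaceForm_pos M s).le)
      hL.1.restrict, integral_eq_lintegral_of_nonneg_ae
      (ae_of_all _ fun ω => (Real.exp_pos _).le) hI.1.restrict,
      ← setLIntegral_expNeg_eInterference M hX hlam hnear hH hXH hNa hv hP hc hs hB]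
    congr 1
    refine lintegral_congr_ae (ae_restrict_of_ae ?_)
    filter_upwards [eInterference_ne_top M hX hH hXH hNa hv hP hc] with ω hω
    rw [interference_eq M hP hc, ← ENNReal.ofReal_toReal hω, ← ENNReal.ofReal_mul (by positivity),
      expNeg_ofReal (by positivity), ENNReal.toReal_ofReal ENNReal.toReal_nonneg]
    congr 2; ring
  · exact ((measurable_laplaceForm M s).comp
      (comap_measurable (dist3 c X 0))).aestronglyMeasurable

/-- The coverage sum is the conditional expectation of the tail of the gain of the serving base
station. -/
lemma coverageSum_ae_eq (hX : IsPoissonProcess μ lam X) (hlam : 0 < lam)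
    (hnear : ∀ᵐ ω ∂μ, ∀ i, ‖X 0 ω‖ ≤ ‖X i ω‖) (hH : IsRayleighFading μ Na v H)
    (hXH : IndepFun (fun ω i => X i ω) (fun ω j i => H j i ω) μ) (hNa : 1 ≤ Na) (hv : 0 < v)
    (hP : 0 < P) (hc : 0 < c) {τ : ℝ} (hτ : 0 < τ) :
    (fun ω => coverageSum M lam P τ Na (dist3 c X 0 ω)) =ᵐ[μ]
      μ[fun ω => erlangTail 1 Na
          (τ / (2 * P * M.pathloss (dist3 c X 0 ω)) * (interference M P c X H ω / v)) |
        MeasurableSpace.comap (dist3 c X 0) inferInstance] ∧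
    Integrable (fun ω => erlangTail 1 Na
      (τ / (2 * P * M.pathloss (dist3 c X 0 ω)) * (interference M P c X H ω / v))) μ := by
  have hD := hX.measurable_dist3 (c := c) 0
  have hIm := measurable_interference M hX hH hP hc
  -- Values in `ℝ≥0` make the conditional law a measure on `ℝ≥0`, as the derivative lemmas require.
  set Y : Ω → ℝ≥0 := fun ω => (interference M P c X H ω / v).toNNReal with hY
  have hYm : Measurable Y := (hIm.div_const _).real_toNNReal
  have hYc : ∀ ω, interference M P c X H ω / v = Y ω := fun ω =>
    (Real.coe_toNNReal _ (div_nonneg (interference_nonneg M hP hc ω) v.2)).symm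
  have hem : Measurable (erlangTail 1 Na) := by unfold erlangTail; fun_prop
  set f : ℝ × ℝ≥0 → ℝ := fun p => erlangTail 1 Na (τ / (2 * P * M.pathloss p.1) * p.2) with hf
  have hfm : Measurable f := by
    have h1 : Measurable fun p : ℝ × ℝ≥0 => M.pathloss p.1 :=
      M.measurable_pathloss.comp measurable_fst
    exact hem.comp (by fun_prop)
  have hs : ∀ ω, 0 < τ / (2 * P * M.pathloss (dist3 c X 0 ω)) := fun ω => by
    have := M.pathloss_pos (dist3_pos (X := X) hc 0 ω)
    positivity
  have hfi : Integrable (fun ω => f (dist3 c X 0 ω, Y ω)) μ := by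
    refine Integrable.of_bound (hfm.comp (hD.prodMk hYm)).aestronglyMeasurable 1
      (ae_of_all _ fun ω => ?_)
    have h0 : 0 ≤ τ / (2 * P * M.pathloss (dist3 c X 0 ω)) * (Y ω : ℝ) :=
      mul_nonneg (hs ω).le (Y ω).2
    rw [Real.norm_of_nonneg (erlangTail_nonneg zero_lt_one _ h0)]
    exact erlangTail_le_one zero_lt_one _ h0
  simp_rw [hYc]
  refine ⟨?_, hfi⟩
  -- Disintegration freezes the serving distance, so the evaluation point `s`, itself a function of
  -- it, becomes a constant.
  have h1 := condExp_prod_ae_eq_integral_condDistrib₀ hD hYm.aemeasurable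
    hfm.aestronglyMeasurable hfi
  refine EventuallyEq.trans ?_ h1.symm
  -- The conditional transform is known almost surely for each fixed argument only; restricting to
  -- rationals gives one null set for all.
  have hq : ∀ᵐ ω ∂μ, ∀ q : ℚ, (0 : ℝ) < q →
      ∫ y : ℝ≥0, Real.exp (-q * y) ∂condDistrib Y (dist3 c X 0) μ (dist3 c X 0 ω) =
        laplaceForm M lam P (dist3 c X 0 ω) q := by
    refine ae_all_iff.2 fun q => ?_
    by_cases hq : (0 : ℝ) < q
    · have h2 := condExp_exp_interference M hX hlam hnear hH hXH hNa hv hP hc hq.le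
      have h3 := integrable_exp_interference M hX hH hP hc hq.le
      simp_rw [hYc] at h2 h3
      have h4 := condExp_prod_ae_eq_integral_condDistrib₀ (f := fun p : ℝ × ℝ≥0 =>
        Real.exp (-q * p.2)) hD hYm.aemeasurable (by fun_prop) h3
      filter_upwards [h2, h4] with ω h5 h6 _
      rw [← h5, ← h6]
    · exact ae_of_all _ fun ω h => absurd h hq
  filter_upwards [hq] with ω hω
  exact sum_iteratedDeriv_laplace (condDistrib Y (dist3 c X 0) μ (dist3 c X 0 ω))
    (contDiffOn_laplaceForm M hP (dist3_pos hc 0 ω)).continuousOn hω (hs ω) Na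

end Coverage

end MISO

theorem corollary2 {Ω : Type*} [MeasurableSpace Ω] (μ : Measure Ω) [IsProbabilityMeasure μ]
    -- system parameters
    (N Na : ℕ) (hNa : 1 ≤ Na) (M : MISO.MultiSlope N)
    (lam : ℝ≥0) (hlam : 0 < lam) (P Δh τ : ℝ) (hP : 0 < P) (hΔh : 0 < Δh) (hτ : 0 < τ)
    -- a Poisson process of BSs, of which BS 0 is the nearest to the typical user
    (X : ℕ → Ω → MISO.Plane) (hX : MISO.IsPoissonProcess μ lam X)
    (hnear : ∀ᵐ ω ∂μ, ∀ i, ‖X 0 ω‖ ≤ ‖X i ω‖)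
    -- the channel vectors, independent of the BSs, with variance v per real dimension
    (v : ℝ≥0) (hv : 0 < v)
    (H : ℕ → ℕ → Ω → Fin Na → ℂ) (hH : MISO.IsRayleighFading μ Na v H)
    (hXH : IndepFun (fun ω i => X i ω) (fun ω j i => H j i ω) μ) :
    -- the interference is almost surely a convergent sum
    (∀ᵐ ω ∂μ, Summable (fun i : ℕ => MISO.power M P Δh X H (i + 1) ω)) ∧
    -- the closed form below is well defined and smooth
    (∀ d : ℝ, 0 < d →
      (∀ s : ℝ, 0 ≤ s → IntegrableOn (MISO.laplaceIntegrand M P s) (Ioi d)) ∧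
      ContDiffOn ℝ ((⊤ : ℕ∞) : WithTop ℕ∞) (MISO.laplaceForm M lam P d) (Ioi 0)) ∧
    -- it is the Laplace transform of the interference (in units of v), given the serving distance
    (∀ s : ℝ, 0 ≤ s →
      μ[fun ω => Real.exp (-s * (MISO.interference M P Δh X H ω / v)) |
          MeasurableSpace.comap (MISO.dist3 Δh X 0) inferInstance]
        =ᵐ[μ] fun ω => MISO.laplaceForm M lam P (MISO.dist3 Δh X 0 ω) s) ∧
    -- coverage probability
    Integrable (fun ω => MISO.coverageSum M lam P τ Na (MISO.dist3 Δh X 0 ω)) μ ∧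
    MISO.coverage μ M P Δh τ X H =
      ∫ ω, MISO.coverageSum M lam P τ Na (MISO.dist3 Δh X 0 ω) ∂μ ∧
    -- spatial throughput
    MISO.spatialThroughput μ M lam P Δh τ X H =
      lam * (∫ ω, MISO.coverageSum M lam P τ Na (MISO.dist3 Δh X 0 ω) ∂μ) *
        Real.logb 2 (1 + τ) := by
  have hD := hX.measurable_dist3 (c := Δh) 0
  obtain ⟨hcov, hint⟩ := MISO.coverageSum_ae_eq M hX hlam hnear hH hXH hNa hv hP hΔh hτ
  have hCP : MISO.coverage μ M P Δh τ X H =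
      ∫ ω, MISO.coverageSum M lam P τ Na (MISO.dist3 Δh X 0 ω) ∂μ := by
    rw [integral_congr_ae hcov, integral_condExp hD.comap_le, MISO.coverage, measureReal_def,
      MISO.measure_coverage M hX hH hXH hNa hv hP hΔh hτ,
      integral_eq_lintegral_of_nonneg_ae (ae_of_all _ fun ω => ?_) hint.1]
    refine MISO.erlangTail_nonneg zero_lt_one _ (mul_nonneg ?_
      (div_nonneg (MISO.interference_nonneg M hP hΔh ω) v.2))
    have := M.pathloss_pos (MISO.dist3_pos (X := X) hΔh 0 ω)
    positivity
  refine ⟨?_, fun d hd => ⟨fun s hs => MISO.integrableOn_laplaceIntegrand M hP hs hd,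
    MISO.contDiffOn_laplaceForm M hP hd⟩, fun s hs =>
    MISO.condExp_exp_interference M hX hlam hnear hH hXH hNa hv hP hΔh hs,
    integrable_condExp.congr hcov.symm, hCP, ?_⟩
  · filter_upwards [MISO.eInterference_ne_top M hX hH hXH hNa hv hP hΔh] with ω hω
    have h := ENNReal.summable_toReal hω
    refine h.congr fun i => ?_
    exact ENNReal.toReal_ofReal (MISO.power_nonneg M hP hΔh (i + 1) ω)
  · rw [← hCP]; rfl
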